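/- Let $\Omega\subset\mathbb R$ be an interval and let $f_0$ be a probability density on $\Omega$ (all densities on $\Omega$ are extended by $0$ to $\mathbb R$). Interaction kernels are functions $\theta\in L^\infty(\mathbb R)$ with $\theta(-r)=\theta(r)$; let $E$ be the Banach space of all such functions with the norm $\|\cdot\|_{L^\infty}$. For $\theta\in E$ and $t\ge 0$, a solution of the forward problem on $[0,t]$ is a curve $f_\theta\in C([0,t];L^1(\Omega))$ with $f_\theta(\cdot,0)=f_0$ and $$\partial_\tau f_\theta(x,\tau)=\int_{\Omega\times\Omega}\theta(x_1-x_2)f_\theta(x_1,\tau)f_\theta(x_2,\tau)\Big[2\delta\big(x-\tfrac{x_1+x_2}{2}\big)-\delta(x-x_1)-\delta(x-x_2)\Big]dx_1\,dx_2 ,$$ where the equation is understood by testing against continuous compactly supported functions of $x$. For $a\in\mathbb R$ put $M_\theta(a,t;f_0)=\int_{-\infty}^a f_\theta(x,t)\,dx$. Let $\theta\in E$ be nonnegative, let $f_\theta$ be a solution of the forward problem on $[0,t]$, and let $g_\theta$ be a bounded measurable solution on $\Omega\times[0,t]$ of the adjoint problem $$\partial_\tau g_\theta(x,\tau)=-\int_\Omega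 2f_\theta(y,\tau)\theta(x-y)\Big[2g_\theta\big(\tfrac{x+y}{2},\tau\big)-g_\theta(x,\tau)-g_\theta(y,\tau)\Big]dy,\qquad g_\theta(x,t)=\mathbf 1_{(-\infty,a]}(x).$$ Then $M_{\theta'}(a,t;f_0)$ is well defined for all $\theta'\in E$ in a neighbourhood of $\theta$ (a solution $f_{\theta'}$ on $[0,t]$ exists, and $M_{\theta'}$ does not depend on the choice of the solution), the function $\theta'\mapsto M_{\theta'}(a,t;f_0)$ is Fréchet differentiable at $\theta$, and its derivative is represented by the function $$\partial_\theta M_\theta(r)=\int_0^t\int_\Omega 2f_\theta(r+y,\tau)f_\theta(y,\tau)\Big[2g_\theta\big(\tfrac r2+y,\tau\big)-g_\theta(r+y,\tau)-g_\theta(y,\tau)\Big]dy\,d\tau ,$$ where the double integral converges absolutely for almost every $r$ and is integrable in $r\in(0,\infty)$. That is, as $\|\tilde\theta\|_{L^\infty}\to0$ with $\tilde\theta\in E$, $$M_{\theta+\tilde\theta}(a,t;f_0)-M_\theta(a,t;f_0)=\int_0^\infty\tilde\theta(r)\,\partial_\theta M_\theta(r)\,dr+o\big(\|\tilde\theta\|_{L^\infty}\big).$$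 -/

import Mathlib

open MeasureTheory Set Filter Topology

noncomputable section

/-- The normed space of symmetric interaction kernels: functions `θ ∈ L^∞(ℝ)` with
`θ(-r) = θ(r)` for almost every `r`, with the essential supremum norm. -/
def SymmKernel : Submodule ℝ (Lp ℝ ⊤ (volume : Measure ℝ)) where
  carrier := {θ | ∀ᵐ r ∂(volume : Measure ℝ), θ (-r) = θ r}
  zero_mem' := by
    have h := Lp.coeFn_zero ℝ ⊤ (volume : Measure ℝ)
    have h' := (Measure.measurePreserving_neg
      (volume : Measure ℝ)).quasiMeasurePreserving.ae h
    change ∀ᵐ r ∂(volume : Measure ℝ), (0 : Lp ℝ ⊤ (volume : Measure ℝ)) (-r) =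
      (0 : Lp ℝ ⊤ (volume : Measure ℝ)) r
    filter_upwards [h, h'] with r h1 h2
    rw [h1, h2]; rfl
  add_mem' := by
    intro u v hu hv
    have h := Lp.coeFn_add u v
    have h' := (Measure.measurePreserving_neg
      (volume : Measure ℝ)).quasiMeasurePreserving.ae h
    change ∀ᵐ r ∂(volume : Measure ℝ), (u + v) (-r) = (u + v) r
    filter_upwards [h, h', hu, hv] with r h1 h2 h3 h4
    rw [h1, h2, Pi.add_apply, Pi.add_apply, h3, h4]
  smul_mem' := by
    intro c u hu
    have h := Lp.coeFn_smul c u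
    have h' := (Measure.measurePreserving_neg
      (volume : Measure ℝ)).quasiMeasurePreserving.ae h
    change ∀ᵐ r ∂(volume : Measure ℝ), (c • u) (-r) = (c • u) r
    filter_upwards [h, h', hu] with r h1 h2 h3
    rw [h1, h2, Pi.smul_apply, Pi.smul_apply, h3]

/-- The values of a kernel. -/
def kernelFun (θ : SymmKernel) : ℝ → ℝ := ((θ : Lp ℝ ⊤ (volume : Measure ℝ)) : ℝ → ℝ)

/-- `f₀` is a probability density on the opinion space `Ω`, extended by zero to `ℝ`. -/
structure IsOpinionDensity (Ω : Set ℝ) (f₀ : ℝ → ℝ) : Prop where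
  integrable : Integrable f₀
  nonneg : ∀ x, 0 ≤ f₀ x
  support : ∀ x, x ∉ Ω → f₀ x = 0
  mass : ∫ x, f₀ x = 1

/-- The right-hand side of the kinetic equation, paired with a test function `φ` in `x`:
`∫∫ θ(x₁-x₂) f(x₁) f(x₂) [2φ((x₁+x₂)/2) - φ(x₁) - φ(x₂)] dx₁ dx₂`.
This is what the Dirac masses in the equation mean. -/
def collisionPairing (Ω : Set ℝ) (θ : ℝ → ℝ) (u : ℝ → ℝ) (φ : ℝ → ℝ) : ℝ :=
  ∫ p in Ω ×ˢ Ω, θ (p.1 - p.2) * u p.1 * u p.2 *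
    (2 * φ ((p.1 + p.2) / 2) - φ p.1 - φ p.2)

/-- `f(x, τ)`, `x ∈ Ω`, `0 ≤ τ ≤ t` (extended by zero in `x`), solves the forward problem with
kernel `θ` and initial density `f₀`: it is a continuous curve in `L¹(Ω)` that starts at `f₀`, and
it is differentiable in time and satisfies the kinetic equation when tested against continuous
compactly supported functions of `x`. -/
structure IsForwardSolution (Ω : Set ℝ) (θ : ℝ → ℝ) (f₀ : ℝ → ℝ) (t : ℝ)
    (f : ℝ → ℝ → ℝ) : Prop where
  integrable : ∀ τ ∈ Icc 0 t, Integrable fun x => f x τ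
  support : ∀ τ ∈ Icc 0 t, ∀ x, x ∉ Ω → f x τ = 0
  continuous : ∀ τ ∈ Icc 0 t,
    Tendsto (fun σ => ∫ x, |f x σ - f x τ|) (𝓝[Icc 0 t] τ) (𝓝 0)
  initial : ∀ᵐ x, f x 0 = f₀ x
  equation : ∀ φ : ℝ → ℝ, Continuous φ → HasCompactSupport φ → ∀ τ ∈ Icc 0 t,
    HasDerivWithinAt (fun σ => ∫ x in Ω, φ x * f x σ)
      (collisionPairing Ω θ (fun x => f x τ) φ) (Icc 0 t) τ

/-- The adjoint operator
`L*[g](x, τ) = ∫_Ω 2 f(y,τ) θ(x-y) [2g((x+y)/2, τ) - g(x,τ) - g(y,τ)] dy`. -/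
def adjointOp (Ω : Set ℝ) (θ : ℝ → ℝ) (f g : ℝ → ℝ → ℝ) (x τ : ℝ) : ℝ :=
  ∫ y in Ω, 2 * f y τ * θ (x - y) * (2 * g ((x + y) / 2) τ - g x τ - g y τ)

/-- `g(x, τ)`, `x ∈ Ω`, `0 ≤ τ ≤ t`, is the (bounded measurable) solution of the adjoint problem
`∂_τ g = -L*[g]` with final condition `g(x, t) = 1_{(-∞, a]}(x)`. Values of `g` outside
`Ω × [0, t]` are irrelevant. -/
structure IsAdjointSolution (Ω : Set ℝ) (θ : ℝ → ℝ) (f : ℝ → ℝ → ℝ) (a t : ℝ)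
    (g : ℝ → ℝ → ℝ) : Prop where
  measurable : Measurable ((Ω ×ˢ Icc 0 t).indicator (Function.uncurry g))
  bounded : ∃ C : ℝ, ∀ x ∈ Ω, ∀ τ ∈ Icc 0 t, |g x τ| ≤ C
  equation : ∀ x ∈ Ω, ∀ τ ∈ Icc 0 t,
    HasDerivWithinAt (fun σ => g x σ) (-(adjointOp Ω θ f g x τ)) (Icc 0 t) τ
  final : ∀ x ∈ Ω, g x t = (Iic a).indicator (fun _ => (1 : ℝ)) x

open Classical in
/-- The measurement `M_θ(a, t; f₀) = ∫_{-∞}^a f_θ(x, t) dx`, where `f_θ` is the solution of the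
forward problem with kernel `θ` on `[0, t]` (with value `0` if there is no solution). -/
def measurement (Ω : Set ℝ) (a t : ℝ) (f₀ : ℝ → ℝ) (θ : SymmKernel) : ℝ :=
  if h : ∃ f : ℝ → ℝ → ℝ, IsForwardSolution Ω (kernelFun θ) f₀ t f then
    ∫ x in Iic a ∩ Ω, h.choose x t
  else 0

/-- `2 f(r+y,τ) f(y,τ) [2g(r/2+y,τ) - g(r+y,τ) - g(y,τ)]`. -/
def gradientIntegrand (f g : ℝ → ℝ → ℝ) (r y τ : ℝ) : ℝ :=
  2 * f (r + y) τ * f y τ * (2 * g (r / 2 + y) τ - g (r + y) τ - g y τ)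

/-- `∫_0^t ∫_Ω 2 f(r+y,τ) f(y,τ) [2g(r/2+y,τ) - g(r+y,τ) - g(y,τ)] dy dτ`. -/
def measurementGradient (Ω : Set ℝ) (t : ℝ) (f g : ℝ → ℝ → ℝ) (r : ℝ) : ℝ :=
  ∫ τ in (0 : ℝ)..t, ∫ y in Ω, gradientIntegrand f g r y τ

end

/-! The kinetic equation is an ordinary differential equation `u' = Q_θ(u, u)` in `L¹(Ω)`, where
`Q_θ` (`collision`) is bounded, bilinear, symmetric, and linear in `θ`. A weak solution satisfies
the integrated equation against every test function, and its right-hand side is continuous in time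
with values in `L¹(Ω)`, so it is a differentiable curve
(`IsForwardSolution.exists_isCollisionCurve`). Uniqueness follows from the local Lipschitz bound.

For `θ'` near `θ`, the field is truncated outside a ball by a Lipschitz retraction, which gives a
solution `G` on all of `[0, t]`. Gronwall's inequality bounds its distance from the solution `F` for
`θ` by `K * ‖θ' - θ‖`, so `G` never reaches the truncation (`IsCollisionCurve.exists_perturbation`).

With `η = θ' - θ` and `w = G - F`, bilinearity gives `w' = 2 Q_θ(w, F) + Q_η(F, F) + (Q_η(G, G) -
Q_η(F, F)) + Q_θ(w, w)`. In the derivative of the pairing of `g` with `w`, the adjoint equation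
cancels the term `2 Q_θ(w, F)` (`integral_adjointOp_mul`), and the last two terms are quadratic in
`‖η‖`. The final value of `g` turns the pairing at time `t` into the difference of the measurements,
whose linear part is therefore the time integral of the pairing of `g` with `Q_η(F, F)`
(`abs_testPairing_sub_sub_integral_le`). Fubini, the substitution `x₁ = r + y`, `x₂ = y`, and
evenness in `r` rewrite this as an integral of `η` over the half-line
(`setIntegral_measurementGradient_mul`). -/

/-! ### Push-forward of densities; midpoint and difference maps. -/

/-- An integrable function can be pushed forward along a quasi-measure-preserving map: there is an
integrable density that has the same integrals against bounded measurable functions. -/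
theorem exists_integrable_pushforward {α β : Type*} {mα : MeasurableSpace α}
    {mβ : MeasurableSpace β} {μ : Measure α} {ν : Measure β} [SigmaFinite ν] {m : α → β}
    (hm : Measure.QuasiMeasurePreserving m μ ν) {h : α → ℝ} (hh : Integrable h μ) :
    ∃ q : β → ℝ, Integrable q ν ∧ ∀ φ : β → ℝ, Measurable φ → ∀ C, (∀ x, |φ x| ≤ C) →
      ∫ x, φ x * q x ∂ν = ∫ p, h p * φ (m p) ∂μ := by
  have key : ∀ k : α → ℝ, Integrable k μ → (∀ p, 0 ≤ k p) →
      ∃ q : β → ℝ, Integrable q ν ∧ ∀ φ : β → ℝ, Measurable φ → ∀ C, (∀ x, |φ x| ≤ C) →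
      ∫ x, φ x * q x ∂ν = ∫ p, k p * φ (m p) ∂μ := by
    intro k hk hk0
    set κ : Measure α := μ.withDensity fun p => ENNReal.ofReal (k p) with hκ
    have hfin : IsFiniteMeasure κ := isFiniteMeasure_withDensity_ofReal hk.2
    -- Absolute continuity survives the push-forward, so the Radon–Nikodym derivative is the
    -- required density.
    have hac : κ.map m ≪ ν :=
      ((withDensity_absolutelyContinuous μ _).map hm.measurable).trans hm.absolutelyContinuous
    refine ⟨fun x => ((κ.map m).rnDeriv ν x).toReal, Measure.integrable_toReal_rnDeriv, ?_⟩
    intro φ hφ C hC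
    have h1 := integral_rnDeriv_smul (f := φ) hac
    simp only [smul_eq_mul] at h1
    simp_rw [mul_comm (φ _)]
    rw [h1, integral_map hm.measurable.aemeasurable hφ.aestronglyMeasurable, hκ,
      integral_withDensity_eq_integral_toReal_smul₀ hk.1.aemeasurable.ennreal_ofReal
        (by simp)]
    simp [ENNReal.toReal_ofReal (hk0 _)]
  -- A signed density is treated through its positive and negative parts.
  obtain ⟨q1, hq1, h1⟩ := key (fun p => max (h p) 0) hh.pos_part (fun p => le_max_right _ _)
  obtain ⟨q2, hq2, h2⟩ := key (fun p => max (-h p) 0) hh.neg_part (fun p => le_max_right _ _)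
  refine ⟨fun x => q1 x - q2 x, hq1.sub hq2, fun φ hφ C hC => ?_⟩
  have hb : ∀ᵐ x ∂ν, ‖φ x‖ ≤ C := .of_forall hC
  have hb' : ∀ᵐ x ∂μ, ‖φ (m x)‖ ≤ C := .of_forall fun x => hC _
  have hm' : AEStronglyMeasurable (fun x => φ (m x)) μ :=
    (hφ.comp hm.measurable).aestronglyMeasurable
  simp_rw [mul_sub]
  rw [integral_sub (hq1.bdd_mul hφ.aestronglyMeasurable hb)
    (hq2.bdd_mul hφ.aestronglyMeasurable hb), h1 φ hφ C hC, h2 φ hφ C hC,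
    ← integral_sub (hh.pos_part.mul_bdd hm' hb') (hh.neg_part.mul_bdd hm' hb')]
  congr 1 with p
  rw [← sub_mul]
  congr 1
  rcases le_total (h p) 0 with h0 | h0
  · rw [max_eq_right h0, max_eq_left (by linarith)]; ring
  · rw [max_eq_left h0, max_eq_right (by linarith)]; ring

theorem measurableSet_of_convex_real {Ω : Set ℝ} (hΩ : Convex ℝ Ω) : MeasurableSet Ω :=
  hΩ.ordConnected.measurableSet

theorem midpoint_mem_of_convex_real {Ω : Set ℝ} (hΩ : Convex ℝ Ω) {x y : ℝ} (hx : x ∈ Ω)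
    (hy : y ∈ Ω) : (x + y) / 2 ∈ Ω := by
  have := hΩ hx hy (a := 1 / 2) (b := 1 / 2) (by norm_num) (by norm_num) (by norm_num)
  simp only [smul_eq_mul] at this
  convert this using 1
  ring

theorem quasiMeasurePreserving_midpoint_real :
    Measure.QuasiMeasurePreserving (fun p : ℝ × ℝ => (p.1 + p.2) / 2) (volume.prod volume)
      volume := by
  have h1 : Measure.QuasiMeasurePreserving (fun x : ℝ => x / 2) volume volume := by
    refine ⟨by fun_prop, ?_⟩
    have h := Real.map_volume_mul_right (a := (2 : ℝ)⁻¹) (by norm_num)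
    simp only [div_eq_mul_inv]
    rw [h]
    exact Measure.smul_absolutelyContinuous
  exact h1.comp (quasiMeasurePreserving_add volume volume)

/-- The midpoint map does not leave a convex set. -/
theorem quasiMeasurePreserving_midpoint_restrict {Ω : Set ℝ} (hΩ : Convex ℝ Ω) :
    Measure.QuasiMeasurePreserving (fun p : ℝ × ℝ => (p.1 + p.2) / 2)
      ((volume.restrict Ω).prod (volume.restrict Ω)) (volume.restrict Ω) := by
  rw [Measure.prod_restrict]
  exact quasiMeasurePreserving_midpoint_real.restrict
    (fun p hp => midpoint_mem_of_convex_real hΩ hp.1 hp.2)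

theorem quasiMeasurePreserving_sub_restrict (Ω : Set ℝ) :
    Measure.QuasiMeasurePreserving (fun p : ℝ × ℝ => p.1 - p.2)
      ((volume.restrict Ω).prod (volume.restrict Ω)) volume := by
  rw [Measure.prod_restrict]
  exact (quasiMeasurePreserving_sub volume volume).mono_left
    Measure.restrict_le_self.absolutelyContinuous

/-! ### Almost-everywhere properties of kernels. -/

theorem ae_abs_kernelFun_le (θ : SymmKernel) : ∀ᵐ r, |kernelFun θ r| ≤ ‖θ‖ := by
  have h := ae_le_eLpNormEssSup (f := (θ : Lp ℝ ⊤ (volume : Measure ℝ)))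
    (μ := (volume : Measure ℝ))
  rw [← eLpNorm_exponent_top] at h
  filter_upwards [h] with r hr
  have := ENNReal.toReal_mono (Lp.eLpNorm_ne_top (θ : Lp ℝ ⊤ (volume : Measure ℝ))) hr
  simpa [kernelFun, Lp.norm_def] using this

theorem measurable_kernelFun (θ : SymmKernel) : Measurable (kernelFun θ) :=
  (Lp.stronglyMeasurable _).measurable

theorem ae_kernelFun_neg (θ : SymmKernel) : ∀ᵐ r, kernelFun θ (-r) = kernelFun θ r := θ.2

theorem ae_kernelFun_sub (θ η : SymmKernel) :
    ∀ᵐ r, kernelFun (θ - η) r = kernelFun θ r - kernelFun η r :=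
  Lp.coeFn_sub (θ : Lp ℝ ⊤ (volume : Measure ℝ)) η

theorem ae_kernelFun_add (θ η : SymmKernel) :
    ∀ᵐ r, kernelFun (θ + η) r = kernelFun θ r + kernelFun η r :=
  Lp.coeFn_add (θ : Lp ℝ ⊤ (volume : Measure ℝ)) η

theorem ae_kernelFun_smul (c : ℝ) (η : SymmKernel) :
    ∀ᵐ r, kernelFun (c • η) r = c * kernelFun η r :=
  Lp.coeFn_smul c (η : Lp ℝ ⊤ (volume : Measure ℝ))

/-! ### `L¹(Ω)` and its pairing with bounded test functions. -/

/-- The space `L¹(Ω)`. -/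
noncomputable abbrev OpinionL1 (Ω : Set ℝ) : Type := ↥(Lp ℝ 1 ((volume : Measure ℝ).restrict Ω))

theorem OpinionL1.integrable {Ω : Set ℝ} (u : OpinionL1 Ω) :
    Integrable u (volume.restrict Ω) := L1.integrable_coeFn u

theorem OpinionL1.norm_eq {Ω : Set ℝ} (u : OpinionL1 Ω) : ‖u‖ = ∫ x in Ω, |u x| :=
  L1.norm_eq_integral_norm u

/-- The pairing of a bounded test function with an element of `L¹(Ω)`. -/
noncomputable def testPairing (Ω : Set ℝ) (φ : ℝ → ℝ) (u : OpinionL1 Ω) : ℝ :=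
  ∫ x in Ω, φ x * u x

theorem integrable_test_mul {Ω : Set ℝ} {φ : ℝ → ℝ} (hφ : Measurable φ) {C : ℝ}
    (hC : ∀ x, |φ x| ≤ C) (u : OpinionL1 Ω) :
    Integrable (fun x => φ x * u x) (volume.restrict Ω) :=
  u.integrable.bdd_mul hφ.aestronglyMeasurable (.of_forall hC)

theorem testPairing_sub {Ω : Set ℝ} {φ : ℝ → ℝ} (hφ : Measurable φ) {C : ℝ}
    (hC : ∀ x, |φ x| ≤ C) (u v : OpinionL1 Ω) :
    testPairing Ω φ (u - v) = testPairing Ω φ u - testPairing Ω φ v := by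
  unfold testPairing
  rw [← integral_sub (integrable_test_mul hφ hC u) (integrable_test_mul hφ hC v)]
  refine integral_congr_ae ?_
  filter_upwards [Lp.coeFn_sub u v] with x hx
  rw [hx, Pi.sub_apply, mul_sub]

theorem testPairing_add {Ω : Set ℝ} {φ : ℝ → ℝ} (hφ : Measurable φ) {C : ℝ}
    (hC : ∀ x, |φ x| ≤ C) (u v : OpinionL1 Ω) :
    testPairing Ω φ (u + v) = testPairing Ω φ u + testPairing Ω φ v := by
  unfold testPairing
  rw [← integral_add (integrable_test_mul hφ hC u) (integrable_test_mul hφ hC v)]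
  refine integral_congr_ae ?_
  filter_upwards [Lp.coeFn_add u v] with x hx
  rw [hx, Pi.add_apply, mul_add]

theorem testPairing_smul {Ω : Set ℝ} (φ : ℝ → ℝ) (c : ℝ) (u : OpinionL1 Ω) :
    testPairing Ω φ (c • u) = c * testPairing Ω φ u := by
  unfold testPairing
  rw [← integral_const_mul]
  refine integral_congr_ae ?_
  filter_upwards [Lp.coeFn_smul c u] with x hx
  rw [hx, Pi.smul_apply, smul_eq_mul]
  ring

theorem abs_testPairing_le {Ω : Set ℝ} {φ : ℝ → ℝ} {C : ℝ}
    (hC : ∀ x, |φ x| ≤ C) (u : OpinionL1 Ω) : |testPairing Ω φ u| ≤ C * ‖u‖ := by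
  unfold testPairing
  rw [u.norm_eq, ← integral_const_mul]
  refine norm_integral_le_of_norm_le (f := fun x => φ x * u x) (u.integrable.abs.const_mul C)
    (.of_forall fun x => ?_)
  rw [Real.norm_eq_abs, abs_mul]
  exact mul_le_mul_of_nonneg_right (hC x) (abs_nonneg _)

/-- The sign of `u` is itself an admissible test function and attains the norm. This is why test
functions are only required to be measurable and bounded. -/
theorem norm_le_of_testPairing_le {Ω : Set ℝ} {u : OpinionL1 Ω} {B : ℝ}
    (h : ∀ φ : ℝ → ℝ, Measurable φ → (∀ x, |φ x| ≤ 1) → testPairing Ω φ u ≤ B) : ‖u‖ ≤ B := by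
  rw [u.norm_eq]
  have hm : Measurable fun x => u x := (Lp.stronglyMeasurable u).measurable
  have h1 := h (fun x => if 0 ≤ u x then 1 else -1)
    (Measurable.ite (measurableSet_le measurable_const hm) measurable_const measurable_const)
    (fun x => by split_ifs <;> simp)
  refine le_trans (le_of_eq ?_) h1
  unfold testPairing
  congr 1 with x
  simp only
  split_ifs with hx
  · rw [abs_of_nonneg hx, one_mul]
  · rw [abs_of_neg (not_le.1 hx)]; ring

theorem eq_of_testPairing_eq {Ω : Set ℝ} {u v : OpinionL1 Ω}
    (h : ∀ φ : ℝ → ℝ, Measurable φ → (∀ x, |φ x| ≤ 1) → testPairing Ω φ u = testPairing Ω φ v) :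
    u = v := by
  have : ‖u - v‖ ≤ 0 := norm_le_of_testPairing_le fun φ hφ hC => by
    rw [testPairing_sub hφ hC, h φ hφ hC, sub_self]
  exact sub_eq_zero.1 (norm_le_zero_iff.1 this)

/-! ### The collision operator on `L¹(Ω)`. -/

/-- The density of interacting pairs. -/
noncomputable def pairDensity (θ : SymmKernel) (u v : ℝ → ℝ) (p : ℝ × ℝ) : ℝ :=
  kernelFun θ (p.1 - p.2) * u p.1 * v p.2

/-- The effect `2φ((x₁+x₂)/2) - φ(x₁) - φ(x₂)` of an interaction on a test function. -/
noncomputable def collisionIncrement (φ : ℝ → ℝ) (p : ℝ × ℝ) : ℝ :=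
  2 * φ ((p.1 + p.2) / 2) - φ p.1 - φ p.2

/-- The polarization of `collisionPairing`. -/
noncomputable def collisionForm (Ω : Set ℝ) (θ : SymmKernel) (u v φ : ℝ → ℝ) : ℝ :=
  ∫ p, pairDensity θ u v p * collisionIncrement φ p
    ∂(((volume : Measure ℝ).restrict Ω).prod (volume.restrict Ω))

theorem collisionPairing_eq_collisionForm (Ω : Set ℝ) (θ : SymmKernel) (u φ : ℝ → ℝ) :
    collisionPairing Ω (kernelFun θ) u φ = collisionForm Ω θ u u φ := by
  rw [collisionForm, Measure.prod_restrict]; rfl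

theorem ae_abs_kernelFun_sub_le (Ω : Set ℝ) (θ : SymmKernel) :
    ∀ᵐ p ∂(((volume : Measure ℝ).restrict Ω).prod (volume.restrict Ω)),
      |kernelFun θ (p.1 - p.2)| ≤ ‖θ‖ :=
  (quasiMeasurePreserving_sub_restrict Ω).ae (ae_abs_kernelFun_le θ)

theorem integrable_pairDensity {Ω : Set ℝ} (θ : SymmKernel) {u v : ℝ → ℝ}
    (hu : Integrable u (volume.restrict Ω)) (hv : Integrable v (volume.restrict Ω)) :
    Integrable (pairDensity θ u v) ((volume.restrict Ω).prod (volume.restrict Ω)) := by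
  have h := (hu.mul_prod hv).bdd_mul (c := ‖θ‖)
    (f := fun p : ℝ × ℝ => kernelFun θ (p.1 - p.2))
    ((measurable_kernelFun θ).comp (measurable_fst.sub measurable_snd)).aestronglyMeasurable
    (ae_abs_kernelFun_sub_le Ω θ)
  refine h.congr (.of_forall fun p => ?_)
  simp only [pairDensity]; ring

theorem measurable_collisionIncrement {φ : ℝ → ℝ} (hφ : Measurable φ) :
    Measurable (collisionIncrement φ) := by
  unfold collisionIncrement; fun_prop

theorem abs_collisionIncrement_le {φ : ℝ → ℝ} {C : ℝ} (hC : ∀ x, |φ x| ≤ C) (p : ℝ × ℝ) :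
    |collisionIncrement φ p| ≤ 4 * C := by
  unfold collisionIncrement
  have h1 := abs_le.1 (hC ((p.1 + p.2) / 2))
  have h2 := abs_le.1 (hC p.1)
  have h3 := abs_le.1 (hC p.2)
  rw [abs_le]; constructor <;> linarith [h1.1, h1.2, h2.1, h2.2, h3.1, h3.2]

theorem integrable_pairDensity_mul {Ω : Set ℝ} (θ : SymmKernel) {u v φ : ℝ → ℝ}
    (hu : Integrable u (volume.restrict Ω)) (hv : Integrable v (volume.restrict Ω))
    (hφ : Measurable φ) {C : ℝ} (hC : ∀ x, |φ x| ≤ C) :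
    Integrable (fun p => pairDensity θ u v p * collisionIncrement φ p)
      ((volume.restrict Ω).prod (volume.restrict Ω)) :=
  (integrable_pairDensity θ hu hv).mul_bdd
    (measurable_collisionIncrement hφ).aestronglyMeasurable
    (.of_forall fun p => abs_collisionIncrement_le hC p)

theorem collisionForm_congr {Ω : Set ℝ} (θ : SymmKernel) {u u' v v' : ℝ → ℝ}
    (hu : u =ᵐ[volume.restrict Ω] u') (hv : v =ᵐ[volume.restrict Ω] v') (φ : ℝ → ℝ) :
    collisionForm Ω θ u v φ = collisionForm Ω θ u' v' φ := by
  refine integral_congr_ae ?_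
  filter_upwards [Measure.quasiMeasurePreserving_fst.ae hu,
    Measure.quasiMeasurePreserving_snd.ae hv] with p h1 h2
  simp only [pairDensity, h1, h2]

theorem abs_collisionForm_le {Ω : Set ℝ} (θ : SymmKernel) (u v : OpinionL1 Ω) {φ : ℝ → ℝ}
    {C : ℝ} (hC : ∀ x, |φ x| ≤ C) :
    |collisionForm Ω θ u v φ| ≤ 4 * C * (‖θ‖ * ‖u‖ * ‖v‖) := by
  have h1 : Integrable (fun p : ℝ × ℝ => |u p.1| * |v p.2|)
      ((volume.restrict Ω).prod (volume.restrict Ω)) := u.integrable.abs.mul_prod v.integrable.abs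
  have h2 : ∫ p : ℝ × ℝ, |u p.1| * |v p.2| ∂((volume.restrict Ω).prod (volume.restrict Ω)) =
      ‖u‖ * ‖v‖ := by
    rw [integral_prod_mul (fun x => |u x|) (fun x => |v x|), u.norm_eq, v.norm_eq]
  have h3 := norm_integral_le_of_norm_le (h1.const_mul (4 * C * ‖θ‖))
    (f := fun p => pairDensity θ u v p * collisionIncrement φ p) ?_
  · rw [integral_const_mul, h2] at h3
    refine h3.trans (le_of_eq (by ring))
  · filter_upwards [ae_abs_kernelFun_sub_le Ω θ] with p hp
    have h4 := abs_collisionIncrement_le hC p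
    rw [Real.norm_eq_abs, pairDensity, abs_mul, abs_mul, abs_mul]
    have : 0 ≤ |u p.1| * |v p.2| := by positivity
    calc |kernelFun θ (p.1 - p.2)| * |u p.1| * |v p.2| * |collisionIncrement φ p|
        = |kernelFun θ (p.1 - p.2)| * |collisionIncrement φ p| * (|u p.1| * |v p.2|) := by ring
      _ ≤ ‖θ‖ * (4 * C) * (|u p.1| * |v p.2|) := by gcongr
      _ = _ := by ring

theorem integral_two_mul_sub_sub {α : Type*} {mα : MeasurableSpace α} {μ : Measure α}
    {f g h : α → ℝ} (hf : Integrable f μ) (hg : Integrable g μ) (hh : Integrable h μ) :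
    ∫ x, (2 * f x - g x - h x) ∂μ = 2 * ∫ x, f x ∂μ - ∫ x, g x ∂μ - ∫ x, h x ∂μ := by
  have h2 : Integrable (fun x => 2 * f x) μ := hf.const_mul 2
  have h3 : Integrable (fun x => 2 * f x - g x) μ := h2.sub hg
  rw [integral_sub h3 hh, integral_sub h2 hg, integral_const_mul]

/-- The gain term and the two loss terms are the push-forwards of one pair density under the
midpoint map and the two projections. Convexity keeps the midpoint in `Ω`. -/
theorem exists_collision {Ω : Set ℝ} (hΩ : Convex ℝ Ω) (θ : SymmKernel) (u v : OpinionL1 Ω) :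
    ∃ q : OpinionL1 Ω, ∀ φ : ℝ → ℝ, Measurable φ → ∀ C, (∀ x, |φ x| ≤ C) →
      testPairing Ω φ q = collisionForm Ω θ u v φ := by
  have hi := integrable_pairDensity θ u.integrable v.integrable
  obtain ⟨q0, h0, e0⟩ := exists_integrable_pushforward
    (quasiMeasurePreserving_midpoint_restrict hΩ) hi
  obtain ⟨q1, h1, e1⟩ := exists_integrable_pushforward
    (ν := volume.restrict Ω) Measure.quasiMeasurePreserving_fst hi
  obtain ⟨q2, h2, e2⟩ := exists_integrable_pushforward
    (ν := volume.restrict Ω) Measure.quasiMeasurePreserving_snd hi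
  have hq : Integrable (fun x => 2 * q0 x - q1 x - q2 x) (volume.restrict Ω) :=
    ((h0.const_mul 2).sub h1).sub h2
  refine ⟨hq.toL1 _, fun φ hφ C hC => ?_⟩
  have hb : ∀ᵐ x ∂(volume.restrict Ω), ‖φ x‖ ≤ C := .of_forall hC
  have hm : ∀ {m : ℝ × ℝ → ℝ}, Measurable m → Integrable (fun p => pairDensity θ u v p * φ (m p))
      ((volume.restrict Ω).prod (volume.restrict Ω)) := fun hm =>
    hi.mul_bdd (hφ.comp hm).aestronglyMeasurable (.of_forall fun p => hC _)
  have hI : ∀ {q : ℝ → ℝ}, Integrable q (volume.restrict Ω) →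
      Integrable (fun x => φ x * q x) (volume.restrict Ω) := fun h =>
    h.bdd_mul hφ.aestronglyMeasurable hb
  calc testPairing Ω φ (hq.toL1 _) = ∫ x in Ω, (2 * (φ x * q0 x) - φ x * q1 x - φ x * q2 x) := by
        refine integral_congr_ae ?_
        filter_upwards [hq.coeFn_toL1] with x hx
        rw [hx]; ring
    _ = _ := by
        have i0 := hm (m := fun p => (p.1 + p.2) / 2) (by fun_prop)
        have i1 := hm measurable_fst
        have i2 := hm measurable_snd
        rw [integral_two_mul_sub_sub (hI h0) (hI h1) (hI h2), e0 φ hφ C hC, e1 φ hφ C hC,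
          e2 φ hφ C hC, ← integral_two_mul_sub_sub i0 i1 i2]
        refine integral_congr_ae (.of_forall fun p => ?_)
        simp only [collisionIncrement]; ring

/-- The collision operator `Q_θ(u, v)` as an element of `L¹(Ω)`. -/
noncomputable def collision {Ω : Set ℝ} (hΩ : Convex ℝ Ω) (θ : SymmKernel) (u v : OpinionL1 Ω) :
    OpinionL1 Ω := (exists_collision hΩ θ u v).choose

section collision

variable {Ω : Set ℝ} (hΩ : Convex ℝ Ω)

theorem testPairing_collision (θ : SymmKernel) (u v : OpinionL1 Ω) {φ : ℝ → ℝ}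
    (hφ : Measurable φ) {C : ℝ} (hC : ∀ x, |φ x| ≤ C) :
    testPairing Ω φ (collision hΩ θ u v) = collisionForm Ω θ u v φ :=
  (exists_collision hΩ θ u v).choose_spec φ hφ C hC

theorem norm_collision_le (θ : SymmKernel) (u v : OpinionL1 Ω) :
    ‖collision hΩ θ u v‖ ≤ 4 * (‖θ‖ * ‖u‖ * ‖v‖) := by
  refine norm_le_of_testPairing_le fun φ hφ hC => ?_
  rw [testPairing_collision hΩ θ u v hφ hC]
  simpa using (le_abs_self _).trans (abs_collisionForm_le θ u v hC)

/-- Exchanging the two particles changes only the sign of the argument of `θ`, so this is where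
evenness of the kernel enters. -/
theorem collision_comm (θ : SymmKernel) (u v : OpinionL1 Ω) :
    collision hΩ θ u v = collision hΩ θ v u := by
  refine eq_of_testPairing_eq fun φ hφ hC => ?_
  rw [testPairing_collision hΩ θ u v hφ hC, testPairing_collision hΩ θ v u hφ hC]
  unfold collisionForm
  rw [← integral_prod_swap]
  refine integral_congr_ae ?_
  filter_upwards [(quasiMeasurePreserving_sub_restrict Ω).ae (ae_kernelFun_neg θ)] with p hp
  have h : p.2 - p.1 = -(p.1 - p.2) := by ring
  simp only [pairDensity, collisionIncrement, Prod.fst_swap, Prod.snd_swap, h, hp,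
    add_comm p.2 p.1]
  ring

theorem collision_sub_left (θ : SymmKernel) (u u' v : OpinionL1 Ω) :
    collision hΩ θ (u - u') v = collision hΩ θ u v - collision hΩ θ u' v := by
  refine eq_of_testPairing_eq fun φ hφ hC => ?_
  rw [testPairing_sub hφ hC, testPairing_collision hΩ θ _ v hφ hC,
    testPairing_collision hΩ θ u v hφ hC, testPairing_collision hΩ θ u' v hφ hC]
  unfold collisionForm
  rw [← integral_sub (integrable_pairDensity_mul θ u.integrable v.integrable hφ hC)
    (integrable_pairDensity_mul θ u'.integrable v.integrable hφ hC)]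
  refine integral_congr_ae ?_
  filter_upwards [Measure.quasiMeasurePreserving_fst.ae (Lp.coeFn_sub u u')] with p hp
  simp only [pairDensity, hp, Pi.sub_apply]
  ring

theorem collision_sub_right (θ : SymmKernel) (u v v' : OpinionL1 Ω) :
    collision hΩ θ u (v - v') = collision hΩ θ u v - collision hΩ θ u v' := by
  rw [collision_comm hΩ θ u, collision_sub_left hΩ, collision_comm hΩ θ v,
    collision_comm hΩ θ v']

theorem collision_sub_kernel (θ θ' : SymmKernel) (u v : OpinionL1 Ω) :
    collision hΩ (θ - θ') u v = collision hΩ θ u v - collision hΩ θ' u v := by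
  refine eq_of_testPairing_eq fun φ hφ hC => ?_
  rw [testPairing_sub hφ hC, testPairing_collision hΩ _ u v hφ hC,
    testPairing_collision hΩ θ u v hφ hC, testPairing_collision hΩ θ' u v hφ hC]
  unfold collisionForm
  rw [← integral_sub (integrable_pairDensity_mul θ u.integrable v.integrable hφ hC)
    (integrable_pairDensity_mul θ' u.integrable v.integrable hφ hC)]
  refine integral_congr_ae ?_
  filter_upwards [(quasiMeasurePreserving_sub_restrict Ω).ae (ae_kernelFun_sub θ θ')] with p hp
  simp only [pairDensity, hp]
  ring

theorem collision_self_sub (θ : SymmKernel) (u v : OpinionL1 Ω) :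
    collision hΩ θ u u - collision hΩ θ v v =
      collision hΩ θ (u - v) u + collision hΩ θ v (u - v) := by
  rw [collision_sub_left hΩ, collision_sub_right hΩ]
  abel

/-- Each of the two terms of `collision_self_sub` contributes `4 * ‖θ‖ * R * ‖u - v‖`. -/
theorem norm_collision_self_sub_le (θ : SymmKernel) (u v : OpinionL1 Ω) {R : ℝ}
    (hu : ‖u‖ ≤ R) (hv : ‖v‖ ≤ R) :
    ‖collision hΩ θ u u - collision hΩ θ v v‖ ≤ 8 * ‖θ‖ * R * ‖u - v‖ := by
  rw [collision_self_sub hΩ]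
  refine (norm_add_le _ _).trans ?_
  have h1 := norm_collision_le hΩ θ (u - v) u
  have h2 := norm_collision_le hΩ θ v (u - v)
  have h3 : ‖θ‖ * ‖u - v‖ * ‖u‖ ≤ ‖θ‖ * ‖u - v‖ * R := by gcongr
  have h4 : ‖θ‖ * ‖v‖ * ‖u - v‖ ≤ ‖θ‖ * R * ‖u - v‖ := by gcongr
  nlinarith

theorem continuous_collision_self (θ : SymmKernel) :
    Continuous fun u : OpinionL1 Ω => collision hΩ θ u u := by
  rw [continuous_iff_continuousAt]
  intro u
  rw [ContinuousAt, tendsto_iff_norm_sub_tendsto_zero]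
  have h : ∀ᶠ v in 𝓝 u, ‖collision hΩ θ v v - collision hΩ θ u u‖ ≤
      8 * ‖θ‖ * (‖u‖ + 1) * ‖v - u‖ := by
    filter_upwards [Metric.ball_mem_nhds u one_pos] with v hv
    refine norm_collision_self_sub_le hΩ θ v u ?_ (by linarith)
    rw [mem_ball_iff_norm] at hv
    have := norm_sub_norm_le v u
    linarith
  refine squeeze_zero' (.of_forall fun v => norm_nonneg _) h ?_
  have : Continuous fun v : OpinionL1 Ω => 8 * ‖θ‖ * (‖u‖ + 1) * ‖v - u‖ := by fun_prop
  simpa using this.tendsto u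

end collision

/-! ### Truncation to a ball and integral curves in Banach spaces. -/

section radial

variable {E : Type*} [NormedAddCommGroup E] [NormedSpace ℝ E]

/-- The radial retraction onto the closed ball of radius `R`. -/
noncomputable def radialRetraction (R : ℝ) (x : E) : E := (R / max R ‖x‖) • x

theorem norm_radialRetraction_le {R : ℝ} (hR : 0 < R) (x : E) : ‖radialRetraction R x‖ ≤ R := by
  have hm : 0 < max R ‖x‖ := lt_max_of_lt_left hR
  rw [radialRetraction, norm_smul, Real.norm_of_nonneg (by positivity), div_mul_eq_mul_div,
    div_le_iff₀ hm]
  exact mul_le_mul_of_nonneg_left (le_max_right _ _) hR.le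

theorem radialRetraction_of_norm_le {R : ℝ} (hR : 0 < R) {x : E} (hx : ‖x‖ ≤ R) :
    radialRetraction R x = x := by
  rw [radialRetraction, max_eq_left hx, div_self hR.ne', one_smul]

theorem norm_radialRetraction_sub_le {R : ℝ} (hR : 0 < R) (x y : E) :
    ‖radialRetraction R x - radialRetraction R y‖ ≤ 2 * ‖x - y‖ := by
  unfold radialRetraction
  set a := max R ‖x‖ with ha
  set b := max R ‖y‖ with hb
  have ha0 : 0 < a := lt_max_of_lt_left hR
  have hb0 : 0 < b := lt_max_of_lt_left hR
  -- The first summand moves the point with a fixed factor, the second changes the factor at a fixed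
  -- point; each costs at most `‖x - y‖`, whence the constant 2.
  have h1 : (R / a) • x - (R / b) • y = (R / a) • (x - y) + (R / a - R / b) • y := by
    rw [smul_sub, sub_smul]; abel
  have h2 : ‖(R / a) • (x - y)‖ ≤ ‖x - y‖ := by
    rw [norm_smul, Real.norm_of_nonneg (by positivity)]
    exact mul_le_of_le_one_left (norm_nonneg _) ((div_le_one ha0).2 (le_max_left _ _))
  have h3 : ‖(R / a - R / b) • y‖ ≤ ‖x - y‖ := by
    have h4 : R / a - R / b = (b - a) * (R / (a * b)) := by field_simp
    have h5 : |b - a| ≤ ‖x - y‖ := by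
      have := abs_max_sub_max_le_abs ‖y‖ ‖x‖ R
      rw [max_comm ‖y‖, max_comm ‖x‖] at this
      refine this.trans ?_
      rw [norm_sub_rev x y]
      exact abs_norm_sub_norm_le y x
    have h6 : R / (a * b) * ‖y‖ ≤ 1 := by
      rw [div_mul_eq_mul_div, div_le_one (by positivity)]
      exact mul_le_mul (le_max_left _ _) (le_max_right _ _) (norm_nonneg _) ha0.le
    rw [norm_smul, h4, Real.norm_eq_abs, abs_mul, abs_of_nonneg (by positivity : 0 ≤ R / (a * b)),
      mul_assoc]
    exact (mul_le_of_le_one_right (abs_nonneg _) h6).trans h5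
  rw [h1]
  linarith [norm_add_le ((R / a) • (x - y)) ((R / a - R / b) • y)]

end radial

/-- A bounded Lipschitz vector field has integral curves on all compact intervals. -/
theorem exists_integralCurve_of_bounded_lipschitz {E : Type*} [NormedAddCommGroup E]
    [NormedSpace ℝ E] [CompleteSpace E] {v : E → E} {K L : NNReal} (hK : LipschitzWith K v)
    (hL : ∀ x, ‖v x‖ ≤ L) (x₀ : E) {t : ℝ} (ht : 0 ≤ t) :
    ∃ α : ℝ → E, α 0 = x₀ ∧ ∀ τ ∈ Icc 0 t, HasDerivWithinAt α (v (α τ)) (Icc 0 t) τ := by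
  -- A curve of speed at most `L` travels at most `L * t`, so a ball of that radius puts no
  -- restriction on the length of the time interval.
  have h : IsPicardLindelof (fun _ => v) (⟨0, left_mem_Icc.2 ht⟩ : Icc 0 t) x₀
      (L * t.toNNReal) 0 L K :=
    IsPicardLindelof.of_time_independent (fun x _ => hL x) hK.lipschitzOnWith
      (by simp [Real.coe_toNNReal t ht, max_eq_left ht])
  exact h.exists_eq_forall_mem_Icc_hasDerivWithinAt₀

theorem hasDerivWithinAt_integral_of_continuousOn {E : Type*} [NormedAddCommGroup E]
    [NormedSpace ℝ E] [CompleteSpace E] {q : ℝ → E} {t : ℝ} (hq : ContinuousOn q (Icc 0 t))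
    {τ : ℝ} (hτ : τ ∈ Icc 0 t) :
    HasDerivWithinAt (fun u => ∫ s in (0 : ℝ)..u, q s) (q τ) (Icc 0 t) τ := by
  have ht : 0 ≤ t := hτ.1.trans hτ.2
  -- Extending `q` by its endpoint values makes it continuous on the line, so the two-sided
  -- fundamental theorem of calculus also covers the endpoints.
  have hc : Continuous (IccExtend ht ((Icc 0 t).domRestrict q)) := hq.domRestrict.Icc_extend'
  have h := (intervalIntegral.integral_hasDerivAt_right (hc.intervalIntegrable 0 τ)
    hc.stronglyMeasurable.stronglyMeasurableAtFilter hc.continuousAt).hasDerivWithinAt (s := Icc 0 t)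
  have he : ∀ s ∈ Icc 0 t, IccExtend ht ((Icc 0 t).domRestrict q) s = q s := fun s hs => by
    rw [IccExtend_of_mem _ _ hs]; rfl
  rw [he τ hτ] at h
  refine h.congr_of_mem (fun u hu => ?_) hτ
  refine intervalIntegral.integral_congr fun s hs => ?_
  rw [uIcc_of_le hu.1] at hs
  exact (he s ⟨hs.1, hs.2.trans hu.2⟩).symm

/-! ### Uniqueness and stability of collision curves. -/

section flow

variable {Ω : Set ℝ} (hΩ : Convex ℝ Ω)

/-- Solutions of the kinetic equation as an ordinary differential equation in `L¹(Ω)`. -/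
def IsCollisionCurve (θ : SymmKernel) (t : ℝ) (F : ℝ → OpinionL1 Ω) : Prop :=
  ∀ τ ∈ Icc 0 t, HasDerivWithinAt F (collision hΩ θ (F τ) (F τ)) (Icc 0 t) τ

variable {hΩ}

theorem IsCollisionCurve.continuousOn {θ : SymmKernel} {t : ℝ} {F : ℝ → OpinionL1 Ω}
    (h : IsCollisionCurve hΩ θ t F) : ContinuousOn F (Icc 0 t) :=
  fun τ hτ => (h τ hτ).continuousWithinAt

theorem IsCollisionCurve.hasDerivWithinAt_Ici {θ : SymmKernel} {t : ℝ} {F : ℝ → OpinionL1 Ω}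
    (h : IsCollisionCurve hΩ θ t F) {τ : ℝ} (hτ : τ ∈ Ico 0 t) :
    HasDerivWithinAt F (collision hΩ θ (F τ) (F τ)) (Ici τ) τ :=
  (h τ (Ico_subset_Icc_self hτ)).mono_of_mem_nhdsWithin (Icc_mem_nhdsGE_of_mem hτ)

theorem IsCollisionCurve.exists_norm_le {θ : SymmKernel} {t : ℝ} {F : ℝ → OpinionL1 Ω}
    (h : IsCollisionCurve hΩ θ t F) : ∃ R, 0 < R ∧ ∀ τ ∈ Icc 0 t, ‖F τ‖ ≤ R := by
  obtain ⟨R, hR⟩ := isCompact_Icc.exists_bound_of_continuousOn h.continuousOn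
  exact ⟨max R 1, by positivity, fun τ hτ => (hR τ hτ).trans (le_max_left _ _)⟩

/-- The quadratic field is only locally Lipschitz; one ball containing both compact trajectories is
enough. -/
theorem IsCollisionCurve.unique {θ : SymmKernel} {t : ℝ} {F G : ℝ → OpinionL1 Ω}
    (hF : IsCollisionCurve hΩ θ t F) (hG : IsCollisionCurve hΩ θ t G) (h0 : F 0 = G 0) :
    EqOn F G (Icc 0 t) := by
  obtain ⟨R, hR, hFR⟩ := hF.exists_norm_le
  obtain ⟨R', hR', hGR⟩ := hG.exists_norm_le
  have hlip : LipschitzOnWith (8 * ‖θ‖ * max R R').toNNReal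
      (fun u : OpinionL1 Ω => collision hΩ θ u u) (Metric.closedBall 0 (max R R')) := by
    refine LipschitzOnWith.of_dist_le_mul fun u hu v hv => ?_
    rw [mem_closedBall_zero_iff] at hu hv
    rw [dist_eq_norm, dist_eq_norm, Real.coe_toNNReal _ (by positivity)]
    exact norm_collision_self_sub_le hΩ θ u v hu hv
  refine ODE_solution_unique_of_mem_Icc_right (v := fun _ u => collision hΩ θ u u)
    (s := fun _ => Metric.closedBall 0 (max R R')) (fun _ _ => hlip) hF.continuousOn
    (fun τ hτ => hF.hasDerivWithinAt_Ici hτ) (fun τ hτ => ?_) hG.continuousOn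
    (fun τ hτ => hG.hasDerivWithinAt_Ici hτ) (fun τ hτ => ?_) h0
  · rw [mem_closedBall_zero_iff]
    exact (hFR τ (Ico_subset_Icc_self hτ)).trans (le_max_left _ _)
  · rw [mem_closedBall_zero_iff]
    exact (hGR τ (Ico_subset_Icc_self hτ)).trans (le_max_right _ _)

theorem gronwallBound_zero_le {K ε x t : ℝ} (hK : 0 < K) (hε : 0 ≤ ε) (hx : x ≤ t) :
    gronwallBound 0 K ε x ≤ ε * (Real.exp (K * t) / K) := by
  rw [gronwallBound_of_K_ne_0 hK.ne']
  beta_reduce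
  rw [zero_mul, zero_add, div_mul_eq_mul_div, mul_div_assoc]
  have : Real.exp (K * x) ≤ Real.exp (K * t) := Real.exp_le_exp.2 (by gcongr)
  gcongr
  linarith

/-- Solutions on `[0, t]` persist under small perturbations of the kernel, and they depend on it in
a Lipschitz way. -/
theorem IsCollisionCurve.exists_perturbation {θ : SymmKernel} {t : ℝ} (ht : 0 ≤ t)
    {F : ℝ → OpinionL1 Ω} (hF : IsCollisionCurve hΩ θ t F) :
    ∃ δ > 0, ∃ R > 0, ∃ K, 0 ≤ K ∧ ∀ θ' : SymmKernel, ‖θ' - θ‖ < δ →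
      ∃ G : ℝ → OpinionL1 Ω, G 0 = F 0 ∧ IsCollisionCurve hΩ θ' t G ∧
        ∀ τ ∈ Icc 0 t, ‖F τ‖ ≤ R ∧ ‖G τ‖ ≤ R ∧ ‖G τ - F τ‖ ≤ K * ‖θ' - θ‖ := by
  obtain ⟨R₀, hR₀, hFR⟩ := hF.exists_norm_le
  -- The margin of 1 over the bound for `F` is the room in which perturbed curves may move.
  set R := R₀ + 1 with hRdef
  have hR : 0 < R := by positivity
  -- A Lipschitz constant of the truncated field of `θ`: 8 from the quadratic term, 2 from the
  -- retraction. The added 1 keeps it positive, so that one may divide by it in the Gronwall bound.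
  set k : ℝ := 16 * ‖θ‖ * R + 1 with hk
  have hk0 : 0 < k := by positivity
  set K : ℝ := 4 * R ^ 2 * (Real.exp (k * t) / k) with hKdef
  have hK0 : 0 ≤ K := by positivity
  have hδ : 0 < 1 / (K + 1) := by positivity
  -- This radius forces `K * ‖θ' - θ‖ ≤ 1`, which is the available margin.
  refine ⟨1 / (K + 1), hδ, R, hR, K, hK0, fun θ' hθ' => ?_⟩
  let v : SymmKernel → OpinionL1 Ω → OpinionL1 Ω := fun θ u =>
    collision hΩ θ (radialRetraction R u) (radialRetraction R u)
  have hvlip : ∀ θ u w, ‖v θ u - v θ w‖ ≤ 16 * ‖θ‖ * R * ‖u - w‖ := fun θ u w => by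
    refine (norm_collision_self_sub_le hΩ θ _ _ (norm_radialRetraction_le hR u)
      (norm_radialRetraction_le hR w)).trans ?_
    have := mul_le_mul_of_nonneg_left (norm_radialRetraction_sub_le hR u w)
      (by positivity : 0 ≤ 8 * ‖θ‖ * R)
    linarith
  have hvbd : ∀ θ u, ‖v θ u‖ ≤ 4 * ‖θ‖ * R ^ 2 := fun θ u => by
    refine (norm_collision_le hΩ θ _ _).trans ?_
    have h1 := norm_radialRetraction_le hR u
    have h2 : ‖θ‖ * ‖radialRetraction R u‖ * ‖radialRetraction R u‖ ≤ ‖θ‖ * R * R := by gcongr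
    linarith
  have hlipθ' : LipschitzWith (16 * ‖θ'‖ * R).toNNReal (v θ') := by
    refine LipschitzWith.of_dist_le_mul fun u w => ?_
    rw [dist_eq_norm, dist_eq_norm, Real.coe_toNNReal _ (by positivity)]
    exact hvlip θ' u w
  have hlipθ : LipschitzWith k.toNNReal (v θ) := by
    refine LipschitzWith.of_dist_le_mul fun u w => ?_
    rw [dist_eq_norm, dist_eq_norm, Real.coe_toNNReal _ hk0.le]
    refine (hvlip θ u w).trans (mul_le_mul_of_nonneg_right ?_ (norm_nonneg _))
    linarith
  obtain ⟨G, hG0, hG⟩ := exists_integralCurve_of_bounded_lipschitz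
    (L := (4 * ‖θ'‖ * R ^ 2).toNNReal) hlipθ'
    (fun u => by rw [Real.coe_toNNReal _ (by positivity)]; exact hvbd θ' u) (F 0) ht
  have hvF : ∀ τ ∈ Icc 0 t, v θ (F τ) = collision hΩ θ (F τ) (F τ) := fun τ hτ => by
    simp only [v]
    rw [radialRetraction_of_norm_le hR ((hFR τ hτ).trans (by linarith))]
  have hdist : ∀ τ ∈ Icc 0 t, ‖G τ - F τ‖ ≤ K * ‖θ' - θ‖ := by
    intro τ hτ
    -- `G` is viewed as an approximate trajectory of the field of `θ`, with defect given by the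
    -- collision operator of `θ' - θ`. Thus the Gronwall constant involves only `θ`, and `K` is
    -- uniform in `θ'`.
    have h := dist_le_of_approx_trajectories_ODE (v := fun _ => v θ) (f := G) (g := F)
      (f' := fun τ => v θ' (G τ)) (g' := fun τ => collision hΩ θ (F τ) (F τ))
      (εf := 4 * ‖θ' - θ‖ * R ^ 2) (εg := 0) (δ := 0) (fun _ => hlipθ)
      (fun τ hτ => (hG τ hτ).continuousWithinAt)
      (fun τ hτ => (hG τ (Ico_subset_Icc_self hτ)).mono_of_mem_nhdsWithin
        (Icc_mem_nhdsGE_of_mem hτ))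
      (fun τ _ => by
        rw [dist_eq_norm]
        simp only [v]
        rw [← collision_sub_kernel]
        exact hvbd (θ' - θ) (G τ))
      hF.continuousOn (fun τ hτ => hF.hasDerivWithinAt_Ici hτ)
      (fun τ hτ => by rw [hvF τ (Ico_subset_Icc_self hτ), dist_self])
      (by rw [hG0, dist_self]) τ hτ
    rw [dist_eq_norm, Real.coe_toNNReal _ hk0.le, add_zero, sub_zero] at h
    refine h.trans ((gronwallBound_zero_le hk0 (by positivity) hτ.2).trans (le_of_eq ?_))
    rw [hKdef]; ring
  have hGR : ∀ τ ∈ Icc 0 t, ‖G τ‖ ≤ R := fun τ hτ => by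
    have h1 := hdist τ hτ
    have h2 : K * ‖θ' - θ‖ ≤ 1 := by
      have h3 := (lt_div_iff₀ (by positivity : 0 < K + 1)).1 hθ'
      nlinarith [norm_nonneg (θ' - θ)]
    have h3 := norm_sub_norm_le (G τ) (F τ)
    linarith [hFR τ hτ]
  refine ⟨G, hG0, fun τ hτ => ?_, fun τ hτ =>
    ⟨(hFR τ hτ).trans (by linarith), hGR τ hτ, hdist τ hτ⟩⟩
  have h := hG τ hτ
  simp only [v] at h
  -- On the ball the retraction is the identity, so `G` solves the untruncated equation.
  rwa [radialRetraction_of_norm_le hR (hGR τ hτ)] at h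

end flow

/-! ### Weak solutions and curves in `L¹(Ω)`. -/

/-- `testPairing` as a continuous linear functional. -/
noncomputable def testPairingCLM {Ω : Set ℝ} {φ : ℝ → ℝ} (hφ : Measurable φ) {C : ℝ}
    (hC : ∀ x, |φ x| ≤ C) : OpinionL1 Ω →L[ℝ] ℝ :=
  LinearMap.mkContinuous
    { toFun := testPairing Ω φ
      map_add' := testPairing_add hφ hC
      map_smul' := fun c u => testPairing_smul φ c u } C (abs_testPairing_le hC)

theorem eq_zero_of_testPairing_continuous {Ω : Set ℝ} (hm : MeasurableSet Ω) {u : OpinionL1 Ω}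
    (h : ∀ φ : ℝ → ℝ, Continuous φ → HasCompactSupport φ → testPairing Ω φ u = 0) : u = 0 := by
  have hi : Integrable (Ω.indicator u) := (integrable_indicator_iff hm).2 u.integrable
  have h0 := ae_eq_zero_of_integral_contDiff_smul_eq_zero hi.locallyIntegrable
    fun φ hφ hc => by
      rw [← h φ hφ.continuous hc, testPairing, ← integral_indicator hm]
      congr 1 with x
      by_cases hx : x ∈ Ω <;> simp [hx]
  rw [Lp.eq_zero_iff_ae_eq_zero]
  filter_upwards [ae_restrict_of_ae (s := Ω) h0, ae_restrict_mem hm] with x hx hxΩ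
  rwa [indicator_of_mem hxΩ] at hx

theorem exists_bound_of_compactSupport {φ : ℝ → ℝ} (hφ : Continuous φ)
    (hc : HasCompactSupport φ) : ∃ C, ∀ x, |φ x| ≤ C :=
  hc.exists_bound_of_continuous hφ

/-- A weak solution is a curve in `L¹(Ω)` that solves the ordinary differential equation. -/
theorem IsForwardSolution.exists_isCollisionCurve {Ω : Set ℝ} (hΩ : Convex ℝ Ω) {θ : SymmKernel}
    {f₀ : ℝ → ℝ} {t : ℝ} {f : ℝ → ℝ → ℝ} (ht : 0 ≤ t)
    (hf : IsForwardSolution Ω (kernelFun θ) f₀ t f) :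
    ∃ F : ℝ → OpinionL1 Ω, IsCollisionCurve hΩ θ t F ∧ F 0 =ᵐ[volume.restrict Ω] f₀ ∧
      ∀ τ ∈ Icc 0 t, F τ =ᵐ[volume.restrict Ω] fun x => f x τ := by
  have hm := measurableSet_of_convex_real hΩ
  have hex : ∀ τ, ∃ u : OpinionL1 Ω, τ ∈ Icc 0 t → u =ᵐ[volume.restrict Ω] fun x => f x τ := by
    intro τ
    by_cases hτ : τ ∈ Icc 0 t
    · exact ⟨((hf.integrable τ hτ).restrict (s := Ω)).toL1 _, fun _ => Integrable.coeFn_toL1 _⟩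
    · exact ⟨0, fun h => absurd h hτ⟩
  choose F hF using hex
  have hcont : ContinuousOn F (Icc 0 t) := by
    intro τ hτ
    rw [ContinuousWithinAt, tendsto_iff_norm_sub_tendsto_zero]
    refine (hf.continuous τ hτ).congr' ?_
    filter_upwards [self_mem_nhdsWithin] with σ hσ
    rw [OpinionL1.norm_eq]
    have h1 : ∫ x in Ω, |(F σ - F τ) x| = ∫ x in Ω, |f x σ - f x τ| := by
      refine integral_congr_ae ?_
      filter_upwards [Lp.coeFn_sub (F σ) (F τ), hF σ hσ, hF τ hτ] with x h1 h2 h3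
      rw [h1, Pi.sub_apply, h2, h3]
    rw [h1, setIntegral_eq_integral_of_forall_compl_eq_zero]
    intro x hx
    rw [hf.support σ hσ x hx, hf.support τ hτ x hx, sub_zero, abs_zero]
  have hq : ContinuousOn (fun τ => collision hΩ θ (F τ) (F τ)) (Icc 0 t) :=
    (continuous_collision_self hΩ θ).comp_continuousOn hcont
  have h0t : (0 : ℝ) ∈ Icc 0 t := left_mem_Icc.2 ht
  -- Against each test function both sides have the same derivative and the same initial value. The
  -- integral on the right is differentiable in norm, which upgrades weak differentiability to
  -- strong.
  have hint : EqOn F (fun τ => F 0 + ∫ s in (0 : ℝ)..τ, collision hΩ θ (F s) (F s)) (Icc 0 t) := by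
    intro τ hτ
    rw [← sub_eq_zero]
    refine eq_zero_of_testPairing_continuous hm fun φ hφ hc => ?_
    obtain ⟨C, hC⟩ := exists_bound_of_compactSupport hφ hc
    let ℓ := testPairingCLM (Ω := Ω) hφ.measurable hC
    have hd1 : ∀ τ ∈ Icc 0 t, HasDerivWithinAt (fun τ => ℓ (F τ))
        (collisionForm Ω θ (F τ) (F τ) φ) (Icc 0 t) τ := by
      intro τ hτ
      have h := hf.equation φ hφ hc τ hτ
      rw [collisionPairing_eq_collisionForm,
        ← collisionForm_congr θ (hF τ hτ) (hF τ hτ)] at h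
      refine h.congr_of_mem (fun σ hσ => ?_) hτ
      refine integral_congr_ae ?_
      filter_upwards [hF σ hσ] with x hx
      rw [hx]
    have hd2 : ∀ τ ∈ Icc 0 t, HasDerivWithinAt
        (fun τ => ℓ (F 0 + ∫ s in (0 : ℝ)..τ, collision hΩ θ (F s) (F s)))
        (collisionForm Ω θ (F τ) (F τ) φ) (Icc 0 t) τ := by
      intro τ hτ
      rw [← testPairing_collision hΩ θ _ _ hφ.measurable hC]
      exact ℓ.hasFDerivAt.comp_hasDerivWithinAt τ
        ((hasDerivWithinAt_integral_of_continuousOn hq hτ).const_add (F 0))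
    have h := norm_image_sub_le_of_norm_deriv_le_segment' (C := 0)
      (fun τ hτ => (hd1 τ hτ).sub (hd2 τ hτ)) (fun τ _ => by simp) τ hτ
    simp only [zero_mul, norm_le_zero_iff, Pi.sub_apply, intervalIntegral.integral_same, add_zero,
      sub_self, sub_zero] at h
    rw [testPairing_sub hφ.measurable hC]
    exact h
  refine ⟨F, fun τ hτ => ?_, ?_, fun τ hτ => hF τ hτ⟩
  · exact ((hasDerivWithinAt_integral_of_continuousOn hq hτ).const_add (F 0)).congr_of_mem hint hτ
  · filter_upwards [hF 0 h0t, ae_restrict_of_ae (s := Ω) hf.initial] with x h1 h2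
    rw [h1, h2]

/-- A solution of the ordinary differential equation in `L¹(Ω)` is a weak solution. -/
theorem IsCollisionCurve.isForwardSolution {Ω : Set ℝ} {hΩ : Convex ℝ Ω} {θ : SymmKernel}
    {f₀ : ℝ → ℝ} (hf₀ : ∀ x, x ∉ Ω → f₀ x = 0) {t : ℝ} {G : ℝ → OpinionL1 Ω}
    (hG : IsCollisionCurve hΩ θ t G) (h0 : G 0 =ᵐ[volume.restrict Ω] f₀) :
    IsForwardSolution Ω (kernelFun θ) f₀ t fun x τ => Ω.indicator (G τ) x := by
  have hm := measurableSet_of_convex_real hΩ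
  have hind : ∀ τ, (fun x => Ω.indicator (G τ) x) =ᵐ[volume.restrict Ω] G τ := fun τ => by
    filter_upwards [ae_restrict_mem hm] with x hx
    rw [indicator_of_mem hx]
  refine ⟨fun τ _ => (integrable_indicator_iff hm).2 (G τ).integrable,
    fun τ _ x hx => indicator_of_notMem hx _, fun τ hτ => ?_, ?_, fun φ hφ hc τ hτ => ?_⟩
  · have h := hG.continuousOn τ hτ
    rw [ContinuousWithinAt, tendsto_iff_norm_sub_tendsto_zero] at h
    refine h.congr fun σ => ?_
    rw [OpinionL1.norm_eq, ← integral_indicator hm]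
    refine integral_congr_ae ?_
    filter_upwards [(ae_restrict_iff' hm).1 (Lp.coeFn_sub (G σ) (G τ))] with x hx
    by_cases hxΩ : x ∈ Ω
    · simp only [indicator_of_mem hxΩ, hx hxΩ, Pi.sub_apply]
    · simp [indicator_of_notMem hxΩ]
  · filter_upwards [(ae_restrict_iff' hm).1 h0] with x hx
    by_cases hxΩ : x ∈ Ω
    · rw [indicator_of_mem hxΩ, hx hxΩ]
    · rw [indicator_of_notMem hxΩ, hf₀ x hxΩ]
  · obtain ⟨C, hC⟩ := exists_bound_of_compactSupport hφ hc
    rw [collisionPairing_eq_collisionForm, collisionForm_congr θ (hind τ) (hind τ),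
      ← testPairing_collision hΩ θ _ _ hφ.measurable hC]
    refine ((testPairingCLM (Ω := Ω) hφ.measurable hC).hasFDerivAt.comp_hasDerivWithinAt τ
      (hG τ hτ)).congr_of_mem (fun σ _ => ?_) hτ
    refine integral_congr_ae ?_
    filter_upwards [hind σ] with x hx
    rw [hx]

/-! ### Pairing with time-dependent test functions. -/

theorem abs_testPairing_sub_test_le {Ω : Set ℝ} {φ ψ : ℝ → ℝ} (hφ : Measurable φ)
    (hψ : Measurable ψ) {C : ℝ} (hφC : ∀ x, |φ x| ≤ C) (hψC : ∀ x, |ψ x| ≤ C) {d : ℝ}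
    (hd : ∀ x, |φ x - ψ x| ≤ d) (u : OpinionL1 Ω) :
    |testPairing Ω φ u - testPairing Ω ψ u| ≤ d * ‖u‖ := by
  have h : testPairing Ω φ u - testPairing Ω ψ u = testPairing Ω (fun x => φ x - ψ x) u := by
    unfold testPairing
    rw [← integral_sub (integrable_test_mul hφ hφC u) (integrable_test_mul hψ hψC u)]
    simp_rw [sub_mul]
  rw [h]
  exact abs_testPairing_le hd u

theorem tendsto_testPairing {Ω : Set ℝ} {ι : Type*} {l : Filter ι} {φ : ι → ℝ → ℝ} {ψ : ℝ → ℝ}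
    (hφ : ∀ i, Measurable (φ i)) (hψ : Measurable ψ) {C : ℝ} (hφC : ∀ i x, |φ i x| ≤ C)
    (hψC : ∀ x, |ψ x| ≤ C) {d : ι → ℝ} (hd : Tendsto d l (𝓝 0))
    (hφψ : ∀ᶠ i in l, ∀ x, |φ i x - ψ x| ≤ d i) {u : ι → OpinionL1 Ω} {v : OpinionL1 Ω}
    (hu : Tendsto u l (𝓝 v)) :
    Tendsto (fun i => testPairing Ω (φ i) (u i)) l (𝓝 (testPairing Ω ψ v)) := by
  rw [tendsto_iff_norm_sub_tendsto_zero]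
  have h : Tendsto (fun i => C * ‖u i - v‖ + d i * ‖v‖) l (𝓝 0) := by
    have := ((tendsto_iff_norm_sub_tendsto_zero.1 hu).const_mul C).add (hd.mul_const ‖v‖)
    simpa using this
  refine squeeze_zero' (.of_forall fun _ => norm_nonneg _) ?_ h
  filter_upwards [hφψ] with i hi
  have h1 := abs_testPairing_le (hφC i) (u i - v)
  rw [testPairing_sub (hφ i) (hφC i)] at h1
  have h2 := abs_testPairing_sub_test_le (hφ i) hψ (hφC i) hψC hi v
  rw [Real.norm_eq_abs]
  linarith [abs_sub_le (testPairing Ω (φ i) (u i)) (testPairing Ω (φ i) v) (testPairing Ω ψ v)]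

/-- The product rule for the pairing of a time-dependent test function, uniformly Lipschitz in time
and differentiable pointwise, with a differentiable curve in `L¹(Ω)`. -/
theorem hasDerivWithinAt_testPairing {Ω : Set ℝ} (hΩ : MeasurableSet Ω) {s : Set ℝ}
    {γ : ℝ → ℝ → ℝ} (hm : ∀ τ, Measurable fun x => γ x τ) {C : ℝ} (hC : ∀ x τ, |γ x τ| ≤ C)
    {K : ℝ} (hK : ∀ x, ∀ σ ∈ s, ∀ τ ∈ s, |γ x σ - γ x τ| ≤ K * |σ - τ|) {τ : ℝ} (hτ : τ ∈ s)
    {a : ℝ → ℝ} (ha : ∀ x ∈ Ω, HasDerivWithinAt (γ x) (a x) s τ) {w : ℝ → OpinionL1 Ω}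
    {w' : OpinionL1 Ω} (hw : HasDerivWithinAt w w' s τ) :
    HasDerivWithinAt (fun σ => testPairing Ω (fun x => γ x σ) (w σ))
      ((∫ x in Ω, a x * w τ x) + testPairing Ω (fun x => γ x τ) w') s τ := by
  rw [hasDerivWithinAt_iff_tendsto_slope] at hw ⊢
  have hs : ∀ᶠ σ in 𝓝[s \ {τ}] τ, σ ∈ s \ {τ} := self_mem_nhdsWithin
  -- The time derivative of `γ` exists only pointwise in `x`; the uniform Lipschitz bound supplies
  -- the integrable majorant.
  have h1 : Tendsto (fun σ => ∫ x in Ω, slope (γ x) τ σ * w τ x) (𝓝[s \ {τ}] τ)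
      (𝓝 (∫ x in Ω, a x * w τ x)) := by
    refine tendsto_integral_filter_of_dominated_convergence (fun x => K * |w τ x|) ?_ ?_
      ((w τ).integrable.abs.const_mul K) ?_
    · refine .of_forall fun σ => ?_
      refine AEStronglyMeasurable.mul ?_ (w τ).integrable.1
      simp only [slope_def_field]
      exact (((hm σ).sub (hm τ)).div_const _).aestronglyMeasurable
    · filter_upwards [hs] with σ hσ
      refine .of_forall fun x => ?_
      rw [norm_mul, Real.norm_eq_abs, Real.norm_eq_abs]
      refine mul_le_mul_of_nonneg_right ?_ (abs_nonneg _)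
      rw [slope_def_field, abs_div, div_le_iff₀ (abs_pos.2 (sub_ne_zero.2 hσ.2))]
      exact hK x σ hσ.1 τ hτ
    · filter_upwards [ae_restrict_mem hΩ] with x hx
      exact (hasDerivWithinAt_iff_tendsto_slope.1 (ha x hx)).mul_const _
  have hd : Tendsto (fun σ => K * |σ - τ|) (𝓝[s \ {τ}] τ) (𝓝 0) := by
    have : Continuous fun σ : ℝ => K * |σ - τ| := by fun_prop
    have h := this.tendsto τ
    simp only [sub_self, abs_zero, mul_zero] at h
    exact h.mono_left nhdsWithin_le_nhds
  have h2 := tendsto_testPairing (φ := fun σ x => γ x σ) hm (hm τ) (fun σ x => hC x σ)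
    (fun x => hC x τ) hd (hs.mono fun σ hσ x => hK x σ hσ.1 τ hτ) hw
  -- The quotient of the product splits with `w` frozen at `τ` in one term and `γ` taken at `σ` in
  -- the other.
  refine (h1.add h2).congr fun σ => ?_
  simp only [slope_def_field, slope_def_module, testPairing_smul]
  rw [testPairing_sub (hm σ) (fun x => hC x σ)]
  have h3 : ∫ x in Ω, (γ x σ - γ x τ) / (σ - τ) * w τ x =
      (σ - τ)⁻¹ * (testPairing Ω (fun x => γ x σ) (w τ) - testPairing Ω (fun x => γ x τ) (w τ)) := by
    unfold testPairing
    rw [← integral_sub (integrable_test_mul (hm σ) (fun x => hC x σ) _)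
      (integrable_test_mul (hm τ) (fun x => hC x τ) _), ← integral_const_mul]
    congr 1 with x
    ring
  rw [h3]
  ring

/-! ### The adjoint problem and the weak first variation. -/

/-- A function on space-time, cut off outside of `Ω × [0, t]`. -/
noncomputable def spaceTimeCutoff (Ω : Set ℝ) (t : ℝ) (g : ℝ → ℝ → ℝ) (x τ : ℝ) : ℝ :=
  (Ω ×ˢ Icc 0 t).indicator (Function.uncurry g) (x, τ)

theorem spaceTimeCutoff_of_mem {Ω : Set ℝ} {t x τ : ℝ} (hx : x ∈ Ω) (hτ : τ ∈ Icc 0 t)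
    (g : ℝ → ℝ → ℝ) : spaceTimeCutoff Ω t g x τ = g x τ :=
  indicator_of_mem (mk_mem_prod hx hτ) _

theorem spaceTimeCutoff_of_notMem {Ω : Set ℝ} {t x : ℝ} (hx : x ∉ Ω) (g : ℝ → ℝ → ℝ) (τ : ℝ) :
    spaceTimeCutoff Ω t g x τ = 0 :=
  indicator_of_notMem (fun h => hx h.1) _

section adjoint

variable {Ω : Set ℝ} {θ : SymmKernel} {f g : ℝ → ℝ → ℝ} {a t : ℝ}

theorem IsAdjointSolution.exists_abs_cutoff_le
    (hg : IsAdjointSolution Ω (kernelFun θ) f a t g) :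
    ∃ C, 0 ≤ C ∧ ∀ x τ, |spaceTimeCutoff Ω t g x τ| ≤ C := by
  obtain ⟨C, hC⟩ := hg.bounded
  refine ⟨max C 0, le_max_right _ _, fun x τ => ?_⟩
  by_cases h : (x, τ) ∈ Ω ×ˢ Icc 0 t
  · rw [spaceTimeCutoff_of_mem h.1 h.2]
    exact (hC x h.1 τ h.2).trans (le_max_left _ _)
  · rw [spaceTimeCutoff, indicator_of_notMem h, abs_zero]
    exact le_max_right _ _

theorem IsAdjointSolution.measurable_cutoff (hg : IsAdjointSolution Ω (kernelFun θ) f a t g)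
    (τ : ℝ) : Measurable fun x => spaceTimeCutoff Ω t g x τ :=
  hg.measurable.comp measurable_prodMk_right

/-- The cutoff is measurable and bounded everywhere, unlike `g` itself. Since midpoints stay in `Ω`,
it alters none of the values of `g` that occur. -/
theorem adjointOp_eq_cutoff (hΩ : Convex ℝ Ω) (θ : SymmKernel) {x τ : ℝ} (hx : x ∈ Ω)
    (hτ : τ ∈ Icc 0 t) {u : ℝ → ℝ} (hu : u =ᵐ[volume.restrict Ω] fun x => f x τ) :
    adjointOp Ω (kernelFun θ) f g x τ = ∫ y in Ω, 2 * (kernelFun θ (x - y) * u y *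
      collisionIncrement (fun x => spaceTimeCutoff Ω t g x τ) (x, y)) := by
  refine integral_congr_ae ?_
  filter_upwards [hu, ae_restrict_mem (measurableSet_of_convex_real hΩ)] with y hy hyΩ
  simp only [collisionIncrement, hy, spaceTimeCutoff_of_mem hx hτ, spaceTimeCutoff_of_mem hyΩ hτ,
    spaceTimeCutoff_of_mem (midpoint_mem_of_convex_real hΩ hx hyΩ) hτ]
  ring

theorem abs_adjointOp_le (hΩ : Convex ℝ Ω) (θ : SymmKernel) {x τ : ℝ} (hx : x ∈ Ω)
    (hτ : τ ∈ Icc 0 t) {u : OpinionL1 Ω} (hu : u =ᵐ[volume.restrict Ω] fun x => f x τ)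
    {C : ℝ} (hC : ∀ x τ, |spaceTimeCutoff Ω t g x τ| ≤ C) :
    |adjointOp Ω (kernelFun θ) f g x τ| ≤ 8 * C * ‖θ‖ * ‖u‖ := by
  rw [adjointOp_eq_cutoff hΩ θ hx hτ hu, u.norm_eq, ← integral_const_mul]
  refine norm_integral_le_of_norm_le (f := fun y => 2 * (kernelFun θ (x - y) * u y *
    collisionIncrement (fun x => spaceTimeCutoff Ω t g x τ) (x, y)))
    (u.integrable.abs.const_mul _) ?_
  have h := (quasiMeasurePreserving_sub_left (volume : Measure ℝ) x).ae (ae_abs_kernelFun_le θ)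
  filter_upwards [ae_restrict_of_ae (s := Ω) h] with y hy
  have h4 := abs_collisionIncrement_le (fun z => hC z τ) (x, y)
  rw [Real.norm_eq_abs, abs_mul, abs_mul, abs_mul, abs_two]
  calc 2 * (|kernelFun θ (x - y)| * |u y| *
        |collisionIncrement (fun x => spaceTimeCutoff Ω t g x τ) (x, y)|)
      ≤ 2 * (‖θ‖ * |u y| * (4 * C)) := by gcongr
    _ = _ := by ring

/-- The adjoint equation bounds the time derivative of `g` independently of `x`; this is the uniform
Lipschitz hypothesis of `hasDerivWithinAt_testPairing`. -/
theorem IsAdjointSolution.abs_cutoff_sub_le (hΩ : Convex ℝ Ω)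
    (hg : IsAdjointSolution Ω (kernelFun θ) f a t g) {F : ℝ → OpinionL1 Ω}
    (hF : ∀ τ ∈ Icc 0 t, F τ =ᵐ[volume.restrict Ω] fun x => f x τ) {R : ℝ} (hR : 0 ≤ R)
    (hFR : ∀ τ ∈ Icc 0 t, ‖F τ‖ ≤ R) {C : ℝ} (hC0 : 0 ≤ C)
    (hC : ∀ x τ, |spaceTimeCutoff Ω t g x τ| ≤ C) (x : ℝ) {σ τ : ℝ} (hσ : σ ∈ Icc 0 t)
    (hτ : τ ∈ Icc 0 t) :
    |spaceTimeCutoff Ω t g x σ - spaceTimeCutoff Ω t g x τ| ≤ 8 * C * ‖θ‖ * R * |σ - τ| := by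
  by_cases hx : x ∈ Ω
  · rw [spaceTimeCutoff_of_mem hx hσ, spaceTimeCutoff_of_mem hx hτ]
    refine Convex.norm_image_sub_le_of_norm_hasDerivWithin_le
      (fun τ hτ => hg.equation x hx τ hτ) (fun τ hτ => ?_) (convex_Icc 0 t) hτ hσ
    rw [norm_neg]
    refine (abs_adjointOp_le hΩ θ hx hτ (hF τ hτ) hC).trans ?_
    exact mul_le_mul_of_nonneg_left (hFR τ hτ) (by positivity)
  · rw [spaceTimeCutoff_of_notMem hx, spaceTimeCutoff_of_notMem hx, sub_zero, abs_zero]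
    positivity

/-- The adjoint operator is dual to the linearized collision operator. -/
theorem integral_adjointOp_mul (hΩ : Convex ℝ Ω)
    (hg : IsAdjointSolution Ω (kernelFun θ) f a t g) {τ : ℝ} (hτ : τ ∈ Icc 0 t)
    {u : OpinionL1 Ω} (hu : u =ᵐ[volume.restrict Ω] fun x => f x τ) (w : OpinionL1 Ω) :
    ∫ x in Ω, adjointOp Ω (kernelFun θ) f g x τ * w x =
      2 * testPairing Ω (fun x => spaceTimeCutoff Ω t g x τ) (collision hΩ θ w u) := by
  obtain ⟨C, hC0, hC⟩ := hg.exists_abs_cutoff_le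
  have hm := hg.measurable_cutoff τ
  rw [testPairing_collision hΩ θ w u hm (fun x => hC x τ), collisionForm,
    integral_prod _ (integrable_pairDensity_mul θ w.integrable u.integrable hm (fun x => hC x τ)),
    ← integral_const_mul]
  refine setIntegral_congr_fun (measurableSet_of_convex_real hΩ) fun x hx => ?_
  simp only [adjointOp_eq_cutoff hΩ θ hx hτ hu]
  rw [← integral_const_mul, ← integral_mul_const]
  congr 1 with y
  simp only [pairDensity]
  ring

/-- The first variation of the measurement, in weak form, with a quadratic remainder. -/
theorem abs_testPairing_sub_sub_integral_le {hΩ : Convex ℝ Ω} {θ' : SymmKernel} (ht : 0 ≤ t)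
    (hg : IsAdjointSolution Ω (kernelFun θ) f a t g) {F G : ℝ → OpinionL1 Ω}
    (hFf : ∀ τ ∈ Icc 0 t, F τ =ᵐ[volume.restrict Ω] fun x => f x τ)
    (hF : IsCollisionCurve hΩ θ t F) (hG : IsCollisionCurve hΩ θ' t G) (h0 : G 0 = F 0)
    {R : ℝ} (hR : 0 ≤ R) (hFR : ∀ τ ∈ Icc 0 t, ‖F τ‖ ≤ R) (hGR : ∀ τ ∈ Icc 0 t, ‖G τ‖ ≤ R)
    {K : ℝ} (hGF : ∀ τ ∈ Icc 0 t, ‖G τ - F τ‖ ≤ K * ‖θ' - θ‖)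
    {C : ℝ} (hC0 : 0 ≤ C) (hC : ∀ x τ, |spaceTimeCutoff Ω t g x τ| ≤ C) :
    |testPairing Ω (fun x => spaceTimeCutoff Ω t g x t) (G t - F t) -
      ∫ τ in (0 : ℝ)..t, testPairing Ω (fun x => spaceTimeCutoff Ω t g x τ)
        (collision hΩ (θ' - θ) (F τ) (F τ))| ≤
      C * (8 * R * K + 4 * ‖θ‖ * K ^ 2) * t * ‖θ' - θ‖ ^ 2 := by
  set γ := spaceTimeCutoff Ω t g
  have hm : ∀ τ, Measurable fun x => γ x τ := hg.measurable_cutoff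
  have hlip : ∀ x, ∀ σ ∈ Icc 0 t, ∀ τ ∈ Icc 0 t,
      |γ x σ - γ x τ| ≤ 8 * C * ‖θ‖ * R * |σ - τ| := fun x σ hσ τ hτ => hg.abs_cutoff_sub_le hΩ hFf hR hFR hC0 hC x (σ := σ) (τ := τ)
    hσ hτ
  have hcont : ContinuousOn (fun τ => testPairing Ω (fun x => γ x τ)
      (collision hΩ (θ' - θ) (F τ) (F τ))) (Icc 0 t) := by
    intro τ hτ
    refine tendsto_testPairing (φ := fun σ x => γ x σ) (d := fun σ => 8 * C * ‖θ‖ * R * |σ - τ|)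
      hm (hm τ) (fun σ x => hC x σ) (fun x => hC x τ) ?_ ?_
      ((continuous_collision_self hΩ _).continuousAt.comp_continuousWithinAt (hF.continuousOn τ hτ))
    · have : Continuous fun σ : ℝ => 8 * C * ‖θ‖ * R * |σ - τ| := by fun_prop
      have h := this.tendsto τ
      simp only [sub_self, abs_zero, mul_zero] at h
      exact h.mono_left nhdsWithin_le_nhds
    · filter_upwards [self_mem_nhdsWithin] with σ hσ x using hlip x σ hσ τ hτ
  -- After subtracting the candidate first variation, only terms of second order in `θ' - θ` remain
  -- in the derivative.
  have hderiv : ∀ τ ∈ Icc 0 t, HasDerivWithinAt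
      (fun τ => testPairing Ω (fun x => γ x τ) (G τ - F τ) -
        ∫ s in (0 : ℝ)..τ, testPairing Ω (fun x => γ x s) (collision hΩ (θ' - θ) (F s) (F s)))
      (testPairing Ω (fun x => γ x τ)
        ((collision hΩ (θ' - θ) (G τ) (G τ) - collision hΩ (θ' - θ) (F τ) (F τ)) +
          collision hΩ θ (G τ - F τ) (G τ - F τ))) (Icc 0 t) τ := by
    intro τ hτ
    have hγd : ∀ x ∈ Ω, HasDerivWithinAt (γ x) (-(adjointOp Ω (kernelFun θ) f g x τ))
        (Icc 0 t) τ := fun x hx =>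
      (hg.equation x hx τ hτ).congr_of_mem (fun σ hσ => spaceTimeCutoff_of_mem hx hσ g) hτ
    have h := (hasDerivWithinAt_testPairing (measurableSet_of_convex_real hΩ) hm hC hlip hτ hγd
      ((hG τ hτ).sub (hF τ hτ))).sub (hasDerivWithinAt_integral_of_continuousOn hcont hτ)
    refine h.congr_deriv ?_
    -- By duality this cancels the linear term `2 Q_θ(G - F, F)` in the derivative of `G - F`.
    have e1 : ∫ x in Ω, -(adjointOp Ω (kernelFun θ) f g x τ) * (G - F) τ x =
        -(2 * testPairing Ω (fun x => γ x τ) (collision hΩ θ (G τ - F τ) (F τ))) := by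
      rw [← integral_adjointOp_mul hΩ hg hτ (hFf τ hτ) (G τ - F τ), ← integral_neg]
      simp_rw [neg_mul]
      rfl
    have hs := fun u v => testPairing_sub (Ω := Ω) (hm τ) (fun x => hC x τ) u v
    have ha := fun u v => testPairing_add (Ω := Ω) (hm τ) (fun x => hC x τ) u v
    rw [e1, ha, collision_sub_right hΩ θ (G τ - F τ), collision_sub_kernel hΩ θ' θ (G τ),
      collision_sub_left hΩ θ (G τ) (F τ) (G τ), collision_sub_left hΩ θ (G τ) (F τ) (F τ),
      collision_comm hΩ θ (F τ) (G τ)]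
    simp only [hs]
    ring
  have hbound : ∀ τ ∈ Ico 0 t, ‖testPairing Ω (fun x => γ x τ)
        ((collision hΩ (θ' - θ) (G τ) (G τ) - collision hΩ (θ' - θ) (F τ) (F τ)) +
          collision hΩ θ (G τ - F τ) (G τ - F τ))‖ ≤
        C * (8 * R * K + 4 * ‖θ‖ * K ^ 2) * ‖θ' - θ‖ ^ 2 := by
    intro τ hτ'
    have hτ := Ico_subset_Icc_self hτ'
    refine (abs_testPairing_le (fun x => hC x τ) _).trans ?_
    rw [mul_assoc]
    refine mul_le_mul_of_nonneg_left ((norm_add_le _ _).trans ?_) hC0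
    have h1 := norm_collision_self_sub_le hΩ (θ' - θ) _ _ (hGR τ hτ) (hFR τ hτ)
    have h2 := norm_collision_le hΩ θ (G τ - F τ) (G τ - F τ)
    have hw := hGF τ hτ
    have h3 : 8 * ‖θ' - θ‖ * R * ‖G τ - F τ‖ ≤ 8 * ‖θ' - θ‖ * R * (K * ‖θ' - θ‖) := by gcongr
    have h4 : ‖θ‖ * ‖G τ - F τ‖ * ‖G τ - F τ‖ ≤ ‖θ‖ * (K * ‖θ' - θ‖) * (K * ‖θ' - θ‖) := by
      have := (norm_nonneg _).trans hw
      gcongr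
    linarith
  have h := norm_image_sub_le_of_norm_deriv_le_segment' hderiv hbound t (right_mem_Icc.2 ht)
  have hz : testPairing Ω (fun x => γ x 0) (G 0 - F 0) = 0 := by
    rw [testPairing_sub (hm 0) (fun x => hC x 0), h0, sub_self]
  simp only [hz, intervalIntegral.integral_same, sub_zero, Real.norm_eq_abs] at h
  refine h.trans (le_of_eq (by ring))

end adjoint

/-! ### The gradient as a space-time integral. -/

/-- The substitution `x₁ = r + y`, `x₂ = y`. As an embedding it allows a change of variables without
measurability conditions on the integrand. -/
theorem measurableEmbedding_shear : MeasurableEmbedding fun p : ℝ × ℝ => (p.1 + p.2, p.2) := by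
  refine Measurable.measurableEmbedding (by fun_prop) fun p q h => ?_
  simp only [Prod.mk.injEq] at h
  exact Prod.ext (by linarith [h.1, h.2]) h.2

theorem gradientIntegrand_eq (f g : ℝ → ℝ → ℝ) (r y τ : ℝ) :
    gradientIntegrand f g r y τ =
      2 * (f (r + y) τ * f y τ * collisionIncrement (fun x => g x τ) (r + y, y)) := by
  have h : (r + y + y) / 2 = r / 2 + y := by ring
  simp only [gradientIntegrand, collisionIncrement, h]
  ring

/-- The reordering `(r, (y, τ)) ↦ (τ, (r, y))`. -/
def timeFirst : ℝ × (ℝ × ℝ) ≃ᵐ ℝ × (ℝ × ℝ) :=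
  MeasurableEquiv.prodAssoc.symm.trans MeasurableEquiv.prodComm

theorem measurePreserving_timeFirst (ν : Measure ℝ) [SFinite ν] :
    MeasurePreserving timeFirst ((volume : Measure ℝ).prod ((volume : Measure ℝ).prod ν))
      (ν.prod ((volume : Measure ℝ).prod volume)) :=
  Measure.measurePreserving_swap.comp
    ((measurePreserving_prodAssoc (volume : Measure ℝ) (volume : Measure ℝ) ν).symm _)

section gradient

variable {Ω : Set ℝ} {θ : SymmKernel} {f g : ℝ → ℝ → ℝ} {f₀ : ℝ → ℝ} {a t : ℝ}

theorem IsForwardSolution.integral_abs_eq_norm (hf : IsForwardSolution Ω (kernelFun θ) f₀ t f)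
    {τ : ℝ} (hτ : τ ∈ Icc 0 t) {u : OpinionL1 Ω} (hu : u =ᵐ[volume.restrict Ω] fun x => f x τ) :
    ∫ x, |f x τ| = ‖u‖ := by
  rw [u.norm_eq, ← setIntegral_eq_integral_of_forall_compl_eq_zero (s := Ω)
    (fun x hx => by rw [hf.support τ hτ x hx, abs_zero])]
  refine integral_congr_ae ?_
  filter_upwards [hu] with x hx
  rw [hx]

/-- Either a factor `f` vanishes, or both endpoints, hence also their midpoint, lie in `Ω`, where
the cutoff has no effect. -/
theorem gradientIntegrand_cutoff (hΩ : Convex ℝ Ω)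
    (hf : IsForwardSolution Ω (kernelFun θ) f₀ t f) {τ : ℝ} (hτ : τ ∈ Icc 0 t) (r y : ℝ) :
    gradientIntegrand f (spaceTimeCutoff Ω t g) r y τ = gradientIntegrand f g r y τ := by
  rw [gradientIntegrand_eq, gradientIntegrand_eq]
  by_cases hy : y ∈ Ω
  · by_cases hx : r + y ∈ Ω
    · simp only [collisionIncrement, spaceTimeCutoff_of_mem hx hτ, spaceTimeCutoff_of_mem hy hτ,
        spaceTimeCutoff_of_mem (midpoint_mem_of_convex_real hΩ hx hy) hτ]
    · simp [hf.support τ hτ _ hx]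
  · simp [hf.support τ hτ _ hy]

theorem gradientIntegrand_of_notMem (hf : IsForwardSolution Ω (kernelFun θ) f₀ t f) {τ : ℝ}
    (hτ : τ ∈ Icc 0 t) (r : ℝ) {y : ℝ} (hy : y ∉ Ω) : gradientIntegrand f g r y τ = 0 := by
  rw [gradientIntegrand_eq, hf.support τ hτ y hy]
  simp

theorem aestronglyMeasurable_gradientIntegrand_cutoff
    (hfm : AEStronglyMeasurable (Function.uncurry f)
      ((volume : Measure ℝ).prod (volume.restrict (Icc 0 t))))
    (hg : IsAdjointSolution Ω (kernelFun θ) f a t g) :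
    AEStronglyMeasurable (fun q : ℝ × (ℝ × ℝ) =>
      gradientIntegrand f (spaceTimeCutoff Ω t g) q.2.1 q.2.2 q.1)
      ((volume.restrict (Icc 0 t)).prod ((volume : Measure ℝ).prod volume)) := by
  have hγ : Measurable fun p : ℝ × ℝ => spaceTimeCutoff Ω t g p.1 p.2 := hg.measurable
  have h1 : Measure.QuasiMeasurePreserving (fun q : ℝ × (ℝ × ℝ) => (q.2.1 + q.2.2, q.1))
      ((volume.restrict (Icc 0 t)).prod ((volume : Measure ℝ).prod volume))
      ((volume : Measure ℝ).prod (volume.restrict (Icc 0 t))) :=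
    Measure.measurePreserving_swap.quasiMeasurePreserving.comp
      (QuasiMeasurePreserving.prodMap (Measure.QuasiMeasurePreserving.id _)
        (quasiMeasurePreserving_add (volume : Measure ℝ) volume))
  have h2 : Measure.QuasiMeasurePreserving (fun q : ℝ × (ℝ × ℝ) => (q.2.2, q.1))
      ((volume.restrict (Icc 0 t)).prod ((volume : Measure ℝ).prod volume))
      ((volume : Measure ℝ).prod (volume.restrict (Icc 0 t))) :=
    Measure.measurePreserving_swap.quasiMeasurePreserving.comp
      (QuasiMeasurePreserving.prodMap (Measure.QuasiMeasurePreserving.id _)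
        Measure.quasiMeasurePreserving_snd)
  have m1 := hfm.comp_quasiMeasurePreserving h1
  have m2 := hfm.comp_quasiMeasurePreserving h2
  have m3 : Measurable fun q : ℝ × (ℝ × ℝ) => 2 * spaceTimeCutoff Ω t g (q.2.1 / 2 + q.2.2) q.1 -
      spaceTimeCutoff Ω t g (q.2.1 + q.2.2) q.1 - spaceTimeCutoff Ω t g q.2.2 q.1 :=
    (((hγ.comp (g := fun p : ℝ × ℝ => spaceTimeCutoff Ω t g p.1 p.2)
      (f := fun q : ℝ × (ℝ × ℝ) => (q.2.1 / 2 + q.2.2, q.1)) (by fun_prop)).const_mul 2).sub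
      (hγ.comp (f := fun q : ℝ × (ℝ × ℝ) => (q.2.1 + q.2.2, q.1)) (by fun_prop))).sub
      (hγ.comp (f := fun q : ℝ × (ℝ × ℝ) => (q.2.2, q.1)) (by fun_prop))
  exact ((m1.const_mul 2).mul m2).mul m3.aestronglyMeasurable

theorem integrable_mul_collisionIncrement {u φ : ℝ → ℝ} (hu : Integrable u) (hφ : Measurable φ)
    {C : ℝ} (hC : ∀ x, |φ x| ≤ C) :
    Integrable (fun p : ℝ × ℝ => 2 * (u p.1 * u p.2 * collisionIncrement φ p))
      ((volume : Measure ℝ).prod volume) :=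
  ((hu.mul_prod hu).mul_bdd (measurable_collisionIncrement hφ).aestronglyMeasurable
    (.of_forall fun p => abs_collisionIncrement_le hC p)).const_mul 2

/-- After the shear, each time slice is a tensor product of `L¹` functions times a bounded factor,
with norm at most `8 * C * R ^ 2`; the time interval is finite. -/
theorem integrable_gradientIntegrand_cutoff (hf : IsForwardSolution Ω (kernelFun θ) f₀ t f)
    (hfm : AEStronglyMeasurable (Function.uncurry f)
      ((volume : Measure ℝ).prod (volume.restrict (Icc 0 t))))
    (hg : IsAdjointSolution Ω (kernelFun θ) f a t g) {R : ℝ}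
    (hR : ∀ τ ∈ Icc 0 t, ∫ x, |f x τ| ≤ R) :
    Integrable (fun q : ℝ × (ℝ × ℝ) =>
      gradientIntegrand f (spaceTimeCutoff Ω t g) q.2.1 q.2.2 q.1)
      ((volume.restrict (Icc 0 t)).prod ((volume : Measure ℝ).prod volume)) := by
  obtain ⟨C, hC0, hC⟩ := hg.exists_abs_cutoff_le
  have hmp := measurePreserving_add_prod (volume : Measure ℝ) (volume : Measure ℝ)
  have hJ := aestronglyMeasurable_gradientIntegrand_cutoff hfm hg
  have hi : ∀ τ ∈ Icc 0 t, Integrable (fun p : ℝ × ℝ => 2 * (f p.1 τ * f p.2 τ *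
      collisionIncrement (fun x => spaceTimeCutoff Ω t g x τ) p))
      ((volume : Measure ℝ).prod volume) := fun τ hτ =>
    integrable_mul_collisionIncrement (hf.integrable τ hτ) (hg.measurable_cutoff τ)
      (fun x => hC x τ)
  rw [integrable_prod_iff hJ]
  refine ⟨?_, Integrable.of_bound hJ.norm.integral_prod_right' (8 * C * (R * R)) ?_⟩
  · filter_upwards [ae_restrict_mem measurableSet_Icc] with τ hτ
    simp only [gradientIntegrand_eq]
    exact (hmp.integrable_comp_emb measurableEmbedding_shear).2 (hi τ hτ)
  · filter_upwards [ae_restrict_mem measurableSet_Icc] with τ hτ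
    simp only [gradientIntegrand_eq]
    rw [hmp.integral_comp measurableEmbedding_shear (fun p : ℝ × ℝ => ‖2 * (f p.1 τ * f p.2 τ *
      collisionIncrement (fun x => spaceTimeCutoff Ω t g x τ) p)‖),
      Real.norm_of_nonneg (integral_nonneg fun _ => norm_nonneg _)]
    have hf1 := (hf.integrable τ hτ).abs
    calc _ ≤ ∫ p : ℝ × ℝ, 8 * C * (|f p.1 τ| * |f p.2 τ|)
          ∂((volume : Measure ℝ).prod volume) := by
          refine integral_mono (hi τ hτ).norm ((hf1.mul_prod hf1).const_mul _) fun p => ?_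
          have h4 := abs_collisionIncrement_le (fun z => hC z τ) p
          simp only [norm_mul, Real.norm_eq_abs, abs_two]
          calc 2 * (|f p.1 τ| * |f p.2 τ| *
                |collisionIncrement (fun x => spaceTimeCutoff Ω t g x τ) p|)
              ≤ 2 * (|f p.1 τ| * |f p.2 τ| * (4 * C)) := by gcongr
            _ = _ := by ring
      _ = 8 * C * ((∫ x, |f x τ|) * ∫ x, |f x τ|) := by
          rw [integral_const_mul, integral_prod_mul (fun x => |f x τ|) (fun x => |f x τ|)]
      _ ≤ 8 * C * (R * R) := by
          have h0 : 0 ≤ ∫ x, |f x τ| := integral_nonneg fun x => abs_nonneg _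
          have h1 := hR τ hτ
          have := h0.trans h1
          gcongr

/-- The representing function of the derivative, as an integral over all of space. -/
theorem measurementGradient_eq (hΩ : Convex ℝ Ω) (hf : IsForwardSolution Ω (kernelFun θ) f₀ t f)
    (ht : 0 ≤ t) (r : ℝ) :
    measurementGradient Ω t f g r =
      ∫ τ in Icc 0 t, ∫ y, gradientIntegrand f (spaceTimeCutoff Ω t g) r y τ := by
  rw [measurementGradient, intervalIntegral.integral_of_le ht, ← integral_Icc_eq_integral_Ioc]
  refine setIntegral_congr_fun measurableSet_Icc fun τ hτ => ?_
  simp only [gradientIntegrand_cutoff hΩ hf hτ]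
  exact setIntegral_eq_integral_of_forall_compl_eq_zero fun y hy =>
    gradientIntegrand_of_notMem hf hτ r hy

/-- Translating `y` by `r` exchanges the two particles, and the integrand is symmetric in them. -/
theorem measurementGradient_neg (hΩ : Convex ℝ Ω)
    (hf : IsForwardSolution Ω (kernelFun θ) f₀ t f) (ht : 0 ≤ t) (r : ℝ) :
    measurementGradient Ω t f g (-r) = measurementGradient Ω t f g r := by
  rw [measurementGradient_eq hΩ hf ht, measurementGradient_eq hΩ hf ht]
  congr 1 with τ
  rw [← integral_add_right_eq_self _ r]
  congr 1 with y
  have h1 : -r + (y + r) = y := by ring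
  have h2 : -r / 2 + (y + r) = r / 2 + y := by ring
  simp only [gradientIntegrand, h1, h2, add_comm r y]
  ring

variable {R : ℝ}

theorem integrable_gradientIntegrand_cutoff_spaceFirst
    (hf : IsForwardSolution Ω (kernelFun θ) f₀ t f)
    (hfm : AEStronglyMeasurable (Function.uncurry f)
      ((volume : Measure ℝ).prod (volume.restrict (Icc 0 t))))
    (hg : IsAdjointSolution Ω (kernelFun θ) f a t g)
    (hR : ∀ τ ∈ Icc 0 t, ∫ x, |f x τ| ≤ R) :
    Integrable (fun q : ℝ × (ℝ × ℝ) =>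
      gradientIntegrand f (spaceTimeCutoff Ω t g) q.1 q.2.1 q.2.2)
      ((volume : Measure ℝ).prod ((volume : Measure ℝ).prod (volume.restrict (Icc 0 t)))) :=
  ((measurePreserving_timeFirst (volume.restrict (Icc 0 t))).integrable_comp_emb
    timeFirst.measurableEmbedding).2 (integrable_gradientIntegrand_cutoff hf hfm hg hR)

theorem ae_integrableOn_gradientIntegrand (hΩ : Convex ℝ Ω)
    (hf : IsForwardSolution Ω (kernelFun θ) f₀ t f)
    (hfm : AEStronglyMeasurable (Function.uncurry f)
      ((volume : Measure ℝ).prod (volume.restrict (Icc 0 t))))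
    (hg : IsAdjointSolution Ω (kernelFun θ) f a t g)
    (hR : ∀ τ ∈ Icc 0 t, ∫ x, |f x τ| ≤ R) :
    ∀ᵐ r, IntegrableOn (fun p : ℝ × ℝ => gradientIntegrand f g r p.1 p.2) (Ω ×ˢ Icc 0 t) := by
  filter_upwards [(integrable_gradientIntegrand_cutoff_spaceFirst hf hfm hg hR).prod_right_ae]
    with r hr
  have h1 : IntegrableOn (fun p : ℝ × ℝ =>
      gradientIntegrand f (spaceTimeCutoff Ω t g) r p.1 p.2) (Ω ×ˢ Icc 0 t) := by
    rw [IntegrableOn, Measure.volume_eq_prod, ← Measure.prod_restrict]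
    exact hr.mono_measure (Measure.prod_mono Measure.restrict_le_self le_rfl)
  refine h1.congr_fun (fun p hp => gradientIntegrand_cutoff hΩ hf hp.2 _ _)
    ((measurableSet_of_convex_real hΩ).prod measurableSet_Icc)

/-- The iterated integral is identified with the product integral only at those `r` whose slice is
integrable, which is almost every `r`. -/
theorem measurementGradient_ae_eq (hΩ : Convex ℝ Ω)
    (hf : IsForwardSolution Ω (kernelFun θ) f₀ t f) (ht : 0 ≤ t)
    (hfm : AEStronglyMeasurable (Function.uncurry f)
      ((volume : Measure ℝ).prod (volume.restrict (Icc 0 t))))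
    (hg : IsAdjointSolution Ω (kernelFun θ) f a t g)
    (hR : ∀ τ ∈ Icc 0 t, ∫ x, |f x τ| ≤ R) :
    measurementGradient Ω t f g =ᵐ[volume] fun r =>
      ∫ p, gradientIntegrand f (spaceTimeCutoff Ω t g) r p.1 p.2
        ∂((volume : Measure ℝ).prod (volume.restrict (Icc 0 t))) := by
  filter_upwards [(integrable_gradientIntegrand_cutoff_spaceFirst hf hfm hg hR).prod_right_ae]
    with r hr
  rw [measurementGradient_eq hΩ hf ht, integral_prod_symm _ hr]

theorem integrable_measurementGradient (hΩ : Convex ℝ Ω)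
    (hf : IsForwardSolution Ω (kernelFun θ) f₀ t f) (ht : 0 ≤ t)
    (hfm : AEStronglyMeasurable (Function.uncurry f)
      ((volume : Measure ℝ).prod (volume.restrict (Icc 0 t))))
    (hg : IsAdjointSolution Ω (kernelFun θ) f a t g)
    (hR : ∀ τ ∈ Icc 0 t, ∫ x, |f x τ| ≤ R) :
    Integrable (measurementGradient Ω t f g) :=
  (integrable_gradientIntegrand_cutoff_spaceFirst hf hfm hg hR).integral_prod_left.congr
    (measurementGradient_ae_eq hΩ hf ht hfm hg hR).symm

theorem integrable_mul_kernelFun {k : ℝ → ℝ} {s : Set ℝ} (hk : IntegrableOn k s)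
    (η : SymmKernel) : IntegrableOn (fun r => k r * kernelFun η r) s :=
  hk.mul_bdd (measurable_kernelFun η).aestronglyMeasurable
    (ae_restrict_of_ae (ae_abs_kernelFun_le η))

theorem integral_eq_two_mul_setIntegral_Ioi_of_even {k : ℝ → ℝ} (hk : Integrable k)
    (he : ∀ᵐ r, k (-r) = k r) : ∫ r, k r = 2 * ∫ r in Ioi (0 : ℝ), k r := by
  rw [← integral_add_compl (measurableSet_Ioi (a := (0 : ℝ))) hk, compl_Ioi]
  have h := integral_comp_neg_Ioi 0 k
  rw [neg_zero] at h
  rw [← h, integral_congr_ae (ae_restrict_of_ae he)]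
  ring

/-- In the coordinates `r = x₁ - x₂`, `y = x₂` the kernel depends on `r` alone. The support of `f`
permits passing from `Ω ×ˢ Ω` to the plane. -/
theorem integral_kernelFun_mul_gradientIntegrand (hΩ : Convex ℝ Ω)
    (hf : IsForwardSolution Ω (kernelFun θ) f₀ t f)
    (hg : IsAdjointSolution Ω (kernelFun θ) f a t g) {τ : ℝ} (hτ : τ ∈ Icc 0 t)
    {u : OpinionL1 Ω} (hu : u =ᵐ[volume.restrict Ω] fun x => f x τ) (η : SymmKernel) :
    ∫ p : ℝ × ℝ, kernelFun η p.1 * gradientIntegrand f (spaceTimeCutoff Ω t g) p.1 p.2 τ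
        ∂((volume : Measure ℝ).prod volume) =
      2 * testPairing Ω (fun x => spaceTimeCutoff Ω t g x τ) (collision hΩ η u u) := by
  obtain ⟨C, hC0, hC⟩ := hg.exists_abs_cutoff_le
  rw [testPairing_collision hΩ η u u (hg.measurable_cutoff τ) (fun x => hC x τ),
    collisionForm_congr η hu hu, collisionForm, Measure.prod_restrict,
    setIntegral_eq_integral_of_forall_compl_eq_zero, ← integral_const_mul,
    ← (measurePreserving_add_prod (volume : Measure ℝ) (volume : Measure ℝ)).integral_comp
      measurableEmbedding_shear (fun p => 2 * (pairDensity η (fun x => f x τ) (fun x => f x τ) p *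
        collisionIncrement (fun x => spaceTimeCutoff Ω t g x τ) p))]
  · congr 1 with p
    simp only [gradientIntegrand_eq, pairDensity, add_sub_cancel_right]
    ring
  · intro p hp
    rcases not_and_or.1 (mt mem_prod.2 hp) with h | h <;>
      simp [pairDensity, hf.support τ hτ _ h]

/-- The first variation of the measurement, in weak and in strong form. -/
theorem setIntegral_measurementGradient_mul (hΩ : Convex ℝ Ω)
    (hf : IsForwardSolution Ω (kernelFun θ) f₀ t f) (ht : 0 ≤ t)
    (hfm : AEStronglyMeasurable (Function.uncurry f)
      ((volume : Measure ℝ).prod (volume.restrict (Icc 0 t))))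
    (hg : IsAdjointSolution Ω (kernelFun θ) f a t g)
    (hR : ∀ τ ∈ Icc 0 t, ∫ x, |f x τ| ≤ R) {F : ℝ → OpinionL1 Ω}
    (hF : ∀ τ ∈ Icc 0 t, F τ =ᵐ[volume.restrict Ω] fun x => f x τ) (η : SymmKernel) :
    ∫ r in Ioi (0 : ℝ), measurementGradient Ω t f g r * kernelFun η r =
      ∫ τ in (0 : ℝ)..t, testPairing Ω (fun x => spaceTimeCutoff Ω t g x τ)
        (collision hΩ η (F τ) (F τ)) := by
  set ν : Measure ℝ := volume.restrict (Icc 0 t) with hν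
  have hk : Integrable fun r => measurementGradient Ω t f g r * kernelFun η r := by
    rw [← integrableOn_univ]
    exact integrable_mul_kernelFun
      (integrable_measurementGradient hΩ hf ht hfm hg hR).integrableOn η
  have heven : ∀ᵐ r, measurementGradient Ω t f g (-r) * kernelFun η (-r) =
      measurementGradient Ω t f g r * kernelFun η r := by
    filter_upwards [ae_kernelFun_neg η] with r hr
    rw [hr, measurementGradient_neg hΩ hf ht]
  have h1 := integral_eq_two_mul_setIntegral_Ioi_of_even hk heven
  have hJ : Integrable (fun q : ℝ × (ℝ × ℝ) => kernelFun η q.2.1 *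
      gradientIntegrand f (spaceTimeCutoff Ω t g) q.2.1 q.2.2 q.1)
      (ν.prod ((volume : Measure ℝ).prod volume)) := by
    refine (integrable_gradientIntegrand_cutoff hf hfm hg hR).bdd_mul (c := ‖η‖)
      ((measurable_kernelFun η).comp (by fun_prop)).aestronglyMeasurable ?_
    exact (Measure.quasiMeasurePreserving_fst.comp
      Measure.quasiMeasurePreserving_snd).ae (ae_abs_kernelFun_le η)
  have hmp := measurePreserving_timeFirst ν
  have hJ' : Integrable (fun q : ℝ × (ℝ × ℝ) => kernelFun η q.1 *
      gradientIntegrand f (spaceTimeCutoff Ω t g) q.1 q.2.1 q.2.2)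
      ((volume : Measure ℝ).prod ((volume : Measure ℝ).prod ν)) :=
    (hmp.integrable_comp_emb timeFirst.measurableEmbedding).2 hJ
  have h2 : ∫ r, measurementGradient Ω t f g r * kernelFun η r =
      ∫ q : ℝ × (ℝ × ℝ), kernelFun η q.2.1 *
        gradientIntegrand f (spaceTimeCutoff Ω t g) q.2.1 q.2.2 q.1
        ∂(ν.prod ((volume : Measure ℝ).prod volume)) := by
    rw [← hmp.integral_comp']
    refine Eq.trans ?_ (integral_prod _ hJ').symm
    refine integral_congr_ae ?_
    filter_upwards [measurementGradient_ae_eq hΩ hf ht hfm hg hR] with r hr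
    rw [hr, mul_comm, ← integral_const_mul]
  have h3 : ∫ q : ℝ × (ℝ × ℝ), kernelFun η q.2.1 *
        gradientIntegrand f (spaceTimeCutoff Ω t g) q.2.1 q.2.2 q.1
        ∂(ν.prod ((volume : Measure ℝ).prod volume)) =
      2 * ∫ τ in (0 : ℝ)..t, testPairing Ω (fun x => spaceTimeCutoff Ω t g x τ)
        (collision hΩ η (F τ) (F τ)) := by
    rw [integral_prod _ hJ, intervalIntegral.integral_of_le ht, ← integral_Icc_eq_integral_Ioc,
      ← integral_const_mul]
    exact setIntegral_congr_fun measurableSet_Icc fun τ hτ =>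
      integral_kernelFun_mul_gradientIntegrand hΩ hf hg hτ (hF τ hτ) η
  -- The factor 2 from folding the line onto the half-line cancels the factor 2 in the gradient.
  linarith

end gradient

/-! ### The measurement and its Fréchet derivative. -/

theorem IsAdjointSolution.setIntegral_Iic_inter {Ω : Set ℝ} (hΩ : Convex ℝ Ω) {θ : SymmKernel}
    {f g : ℝ → ℝ → ℝ} {a t : ℝ} (ht : 0 ≤ t) (hg : IsAdjointSolution Ω (kernelFun θ) f a t g)
    {u : OpinionL1 Ω} {v : ℝ → ℝ} (hu : u =ᵐ[volume.restrict Ω] v) :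
    ∫ x in Iic a ∩ Ω, v x = testPairing Ω (fun x => spaceTimeCutoff Ω t g x t) u := by
  rw [← Measure.restrict_restrict measurableSet_Iic, ← integral_indicator measurableSet_Iic]
  refine integral_congr_ae ?_
  filter_upwards [hu, ae_restrict_mem (measurableSet_of_convex_real hΩ)] with x hx hxΩ
  rw [spaceTimeCutoff_of_mem hxΩ (right_mem_Icc.2 ht), hg.final x hxΩ, hx]
  by_cases h : x ∈ Iic a <;> simp [h]

/-- Two weak solutions coincide at the final time. -/
theorem IsForwardSolution.ae_eq_of_isCollisionCurve {Ω : Set ℝ} {hΩ : Convex ℝ Ω}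
    {θ : SymmKernel} {f₀ : ℝ → ℝ} {t : ℝ} (ht : 0 ≤ t) {f : ℝ → ℝ → ℝ}
    (hf : IsForwardSolution Ω (kernelFun θ) f₀ t f) {G : ℝ → OpinionL1 Ω}
    (hG : IsCollisionCurve hΩ θ t G) (h0 : G 0 =ᵐ[volume.restrict Ω] f₀) :
    G t =ᵐ[volume.restrict Ω] fun x => f x t := by
  obtain ⟨F, hF, hF0, hFf⟩ := hf.exists_isCollisionCurve hΩ ht
  have h : F 0 = G 0 := Lp.ext (hF0.trans h0.symm)
  rw [← hF.unique hG h (right_mem_Icc.2 ht)]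
  exact hFf t (right_mem_Icc.2 ht)

/-- A value common to all solutions makes the arbitrary choice in `measurement` harmless. -/
theorem measurement_eq {Ω : Set ℝ} {a t : ℝ} {f₀ : ℝ → ℝ} {θ : SymmKernel} {c : ℝ}
    (hex : ∃ f, IsForwardSolution Ω (kernelFun θ) f₀ t f)
    (h : ∀ f, IsForwardSolution Ω (kernelFun θ) f₀ t f → ∫ x in Iic a ∩ Ω, f x t = c) :
    measurement Ω a t f₀ θ = c := by
  rw [measurement, dif_pos hex]
  exact h _ hex.choose_spec

/-- Integration over the half-line against an integrable function, as a functional of the kernel. -/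
noncomputable def kernelFunctional {k : ℝ → ℝ} (hk : IntegrableOn k (Ioi 0)) :
    SymmKernel →L[ℝ] ℝ :=
  LinearMap.mkContinuous
    { toFun := fun η => ∫ r in Ioi (0 : ℝ), k r * kernelFun η r
      map_add' := fun η η' => by
        rw [← integral_add (integrable_mul_kernelFun hk η) (integrable_mul_kernelFun hk η')]
        refine integral_congr_ae ?_
        filter_upwards [ae_restrict_of_ae (ae_kernelFun_add η η')] with r hr
        rw [hr, mul_add]
      map_smul' := fun c η => by
        rw [RingHom.id_apply, smul_eq_mul, ← integral_const_mul]
        refine integral_congr_ae ?_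
        filter_upwards [ae_restrict_of_ae (ae_kernelFun_smul c η)] with r hr
        rw [hr]; ring }
    (∫ r in Ioi (0 : ℝ), |k r|) fun η => by
      rw [← integral_mul_const]
      refine norm_integral_le_of_norm_le (f := fun r => k r * kernelFun η r)
        (hk.abs.mul_const _) ?_
      filter_upwards [ae_restrict_of_ae (ae_abs_kernelFun_le η)] with r hr
      rw [Real.norm_eq_abs, abs_mul]
      gcongr

theorem theorem3 (Ω : Set ℝ) (hΩ : Convex ℝ Ω) (f₀ : ℝ → ℝ) (hf₀ : IsOpinionDensity Ω f₀)
    (a t : ℝ) (ht : 0 ≤ t)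
    (θ : SymmKernel) (hθ : ∀ᵐ r, 0 ≤ kernelFun θ r)
    (f g : ℝ → ℝ → ℝ)
    (hf : IsForwardSolution Ω (kernelFun θ) f₀ t f)
    (hfm : AEStronglyMeasurable (Function.uncurry f)
      ((volume : Measure ℝ).prod (volume.restrict (Icc 0 t))))
    (hg : IsAdjointSolution Ω (kernelFun θ) f a t g) :
    -- the measurement is well defined for all kernels near `θ`
    (∀ᶠ θ' in 𝓝 θ, (∃ f', IsForwardSolution Ω (kernelFun θ') f₀ t f') ∧
      ∀ f', IsForwardSolution Ω (kernelFun θ') f₀ t f' →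
        measurement Ω a t f₀ θ' = ∫ x in Iic a ∩ Ω, f' x t) ∧
    -- the integrals in the formula converge
    (∀ᵐ r, IntegrableOn (fun p : ℝ × ℝ => gradientIntegrand f g r p.1 p.2) (Ω ×ˢ Icc 0 t)) ∧
    IntegrableOn (measurementGradient Ω t f g) (Ioi 0) ∧
    -- the Fréchet derivative at `θ` is represented by the given function of `r`
    ∃ D : SymmKernel →L[ℝ] ℝ,
      HasFDerivAt (measurement Ω a t f₀) D θ ∧
      ∀ η : SymmKernel,
        D η = ∫ r in Ioi (0 : ℝ), measurementGradient Ω t f g r * kernelFun η r := by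
  obtain ⟨F, hF, hF0, hFf⟩ := hf.exists_isCollisionCurve hΩ ht
  obtain ⟨δ, hδ, R, hR, K, hK, hpert⟩ := hF.exists_perturbation ht
  obtain ⟨C, hC0, hC⟩ := hg.exists_abs_cutoff_le
  have htt : t ∈ Icc 0 t := right_mem_Icc.2 ht
  have hFR : ∀ τ ∈ Icc 0 t, ‖F τ‖ ≤ R := fun τ hτ => by
    -- The trivial perturbation `θ' = θ` yields the bound on `F` itself.
    obtain ⟨_, _, _, h⟩ := hpert θ (by simpa using hδ)
    exact (h τ hτ).1
  have hfR : ∀ τ ∈ Icc 0 t, ∫ x, |f x τ| ≤ R := fun τ hτ => by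
    rw [hf.integral_abs_eq_norm hτ (hFf τ hτ)]
    exact hFR τ hτ
  have hsol : ∀ {θ' : SymmKernel} {G : ℝ → OpinionL1 Ω}, G 0 = F 0 → IsCollisionCurve hΩ θ' t G →
      (∃ f', IsForwardSolution Ω (kernelFun θ') f₀ t f') ∧
      ∀ f', IsForwardSolution Ω (kernelFun θ') f₀ t f' → ∫ x in Iic a ∩ Ω, f' x t =
        testPairing Ω (fun x => spaceTimeCutoff Ω t g x t) (G t) := by
    intro θ' G h0 hG
    have hG0 : G 0 =ᵐ[volume.restrict Ω] f₀ := by rw [h0]; exact hF0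
    exact ⟨⟨_, hG.isForwardSolution hf₀.support hG0⟩, fun f' hf' =>
      hg.setIntegral_Iic_inter hΩ ht (hf'.ae_eq_of_isCollisionCurve ht hG hG0)⟩
  have hnear : ∀ᶠ θ' in 𝓝 θ, ‖θ' - θ‖ < δ := by
    filter_upwards [Metric.ball_mem_nhds θ hδ] with θ' h
    rwa [mem_ball_iff_norm] at h
  have hint := integrable_measurementGradient hΩ hf ht hfm hg hfR
  refine ⟨?_, ae_integrableOn_gradientIntegrand hΩ hf hfm hg hfR, hint.integrableOn,
    kernelFunctional hint.integrableOn, ?_, fun η => rfl⟩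
  · filter_upwards [hnear] with θ' h
    obtain ⟨G, h0, hG, -⟩ := hpert θ' h
    obtain ⟨hex, hval⟩ := hsol h0 hG
    exact ⟨hex, fun f' hf' => by rw [measurement_eq hex hval, hval f' hf']⟩
  · set D := kernelFunctional hint.integrableOn
    have hMθ : measurement Ω a t f₀ θ =
        testPairing Ω (fun x => spaceTimeCutoff Ω t g x t) (F t) :=
      measurement_eq (hsol rfl hF).1 (hsol rfl hF).2
    have hO : (fun θ' => measurement Ω a t f₀ θ' - measurement Ω a t f₀ θ - D (θ' - θ))
        =O[𝓝 θ] fun θ' => ‖θ' - θ‖ ^ 2 := by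
      refine Asymptotics.IsBigO.of_bound (C * (8 * R * K + 4 * ‖θ‖ * K ^ 2) * t) ?_
      filter_upwards [hnear] with θ' h
      obtain ⟨G, h0, hG, hb⟩ := hpert θ' h
      have hD : D (θ' - θ) = ∫ τ in (0 : ℝ)..t, testPairing Ω
          (fun x => spaceTimeCutoff Ω t g x τ) (collision hΩ (θ' - θ) (F τ) (F τ)) :=
        setIntegral_measurementGradient_mul hΩ hf ht hfm hg hfR hFf (θ' - θ)
      rw [hMθ, measurement_eq (hsol h0 hG).1 (hsol h0 hG).2, hD,
        ← testPairing_sub (hg.measurable_cutoff t) (fun x => hC x t), Real.norm_eq_abs,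
        Real.norm_of_nonneg (by positivity)]
      exact abs_testPairing_sub_sub_integral_le ht hg hFf hF hG h0 hR.le hFR
        (fun τ hτ => (hb τ hτ).2.1) (fun τ hτ => (hb τ hτ).2.2) hC0 hC
    -- A remainder of order two has zero derivative at `θ`; restoring the affine part leaves `D`.
    have h0 := hO.hasFDerivAt (𝕜 := ℝ) one_lt_two
    have h1 := (h0.add (D.hasFDerivAt.comp θ ((hasFDerivAt_id θ).sub_const θ))).add_const
      (measurement Ω a t f₀ θ)
    refine (h1.congr_fderiv (by ext; simp)).congr_of_eventuallyEq (.of_forall fun θ' => ?_)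
    simp
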